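/- Let $\mathfrak{Ba}=(B,\wedge,\vee,0,1,\neg)$ be the countable atomless Boolean algebra (with $0\neq 1$), regarded also as a Boolean ring ($x+y$ is the symmetric difference, $xy=x\wedge y$). A functional reduct of $\mathfrak{Ba}$ is a structure $(B,t_1,\dots,t_k)$ in which every $t_j$ is a term function of $\mathfrak{Ba}$ (constants are allowed as nullary term functions); its automorphism group consists of the permutations of $B$ commuting with all $t_j$. Write $\operatorname{Aut}(t_1,\dots,t_k)$ for this group, and put $\neg(x)=x+1$, $+_0(x,y)=x+y$, $+_1(x,y)=x+y+1$, $\Sigma(x,y,z)=x+y+z$, $\Sigma_1(x,y,z)=x+y+z+1$, $M(x,y,z)=xy+yz+zx$. Then: 1. The automorphism groups of functional reducts of $\mathfrak{Ba}$ are exactly the following 13 pairwise distinct groups: $\operatorname{Aut}(\mathfrak{Ba})$, $\operatorname{Aut}(M)$; the groups $\operatorname{Aut}(0)$, $\operatorname{Aut}(1)$, $\operatorname{Aut}(x)=\operatorname{Sym}(B)$, $\operatorname{Aut}(\neg)$, $\operatorname{Aut}(+_0)$, $\operatorname{Aut}(+_1)$, $\operatorname{Aut}(\Sigma)$, $\operatorname{Aut}(\Sigma_1)$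 of the eight canonical linear functions; and the three intersections $\operatorname{Aut}(0,1)=\operatorname{Aut}(0)\cap\operatorname{Aut}(1)$, $\operatorname{Aut}(\neg,0,1)=\operatorname{Aut}(0)\cap\operatorname{Aut}(1)\cap\operatorname{Aut}(\neg)$, $\operatorname{Aut}(+_0,0,1)=\operatorname{Aut}(0)\cap\operatorname{Aut}(1)\cap\operatorname{Aut}(\Sigma)$. The group of a functional reduct is $\operatorname{Aut}(\mathfrak{Ba})$ or $\operatorname{Aut}(M)$ if and only if one of its operations is non-linear, i.e. not of the form $x_{i_1}+\dots+x_{i_m}+c$ with distinct variables and $c\in\{0,1\}$. 2. Ordered by inclusion, these groups form a lattice whose meets are intersections and whose covering pairs (smaller group first) are exactly: $\operatorname{Aut}(\mathfrak{Ba})<\operatorname{Aut}(M)$ and $\operatorname{Aut}(\mathfrak{Ba})<\operatorname{Aut}(+_0,0,1)$; $\operatorname{Aut}(M)<\operatorname{Aut}(\Sigma_1)$; $\operatorname{Aut}(+_0,0,1)<\operatorname{Aut}(\neg,0,1),\ \operatorname{Aut}(+_0),\ \operatorname{Aut}(+_1),\ \operatorname{Aut}(\Sigma_1)$; $\operatorname{Aut}(\neg,0,1)<\operatorname{Aut}(0,1),\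 \operatorname{Aut}(\neg)$; $\operatorname{Aut}(0,1)<\operatorname{Aut}(0),\ \operatorname{Aut}(1)$; $\operatorname{Aut}(+_0)<\operatorname{Aut}(0),\ \operatorname{Aut}(\Sigma)$; $\operatorname{Aut}(+_1)<\operatorname{Aut}(1),\ \operatorname{Aut}(\Sigma)$; $\operatorname{Aut}(\Sigma_1)<\operatorname{Aut}(\Sigma),\ \operatorname{Aut}(\neg)$; and each of $\operatorname{Aut}(0),\operatorname{Aut}(1),\operatorname{Aut}(\Sigma),\operatorname{Aut}(\neg)$ is covered by $\operatorname{Sym}(B)$. 3. Two functional reducts are first-order interdefinable (the operations of each are definable without parameters over the other) if and only if their automorphism groups are equal; hence there are exactly 13 functional reducts up to first-order interdefinability. -/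

import Mathlib

open scoped symmDiff

namespace BooleanReduct

universe u

/-- The term functions of a Boolean algebra `(B, ∧, ∨, 0, 1, ¬)`, of any finite arity `n`:
the functions obtained from the projections and the constants `0`, `1` by the operations. -/
inductive IsTermFunction {B : Type u} [BooleanAlgebra B] {n : ℕ} : ((Fin n → B) → B) → Prop
  | proj (i : Fin n) : IsTermFunction (fun v => v i)
  | bot : IsTermFunction (fun _ => ⊥)
  | top : IsTermFunction (fun _ => ⊤)
  | compl {f : (Fin n → B) → B} : IsTermFunction f → IsTermFunction (fun v => (f v)ᶜ)
  | inf {f g : (Fin n → B) → B} :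
      IsTermFunction f → IsTermFunction g → IsTermFunction (fun v => f v ⊓ g v)
  | sup {f g : (Fin n → B) → B} :
      IsTermFunction f → IsTermFunction g → IsTermFunction (fun v => f v ⊔ g v)

/-- Addition of the Boolean ring is the symmetric difference; it is a term function. -/
theorem IsTermFunction.add {B : Type u} [BooleanAlgebra B] {n : ℕ} {f g : (Fin n → B) → B}
    (hf : IsTermFunction f) (hg : IsTermFunction g) : IsTermFunction (fun v => f v ∆ g v) := by
  have h := ((hf.inf hg.compl).sup (hg.inf hf.compl))
  simpa only [symmDiff, sdiff_eq] using h

/-- A term function together with its arity. -/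
structure TermOp (B : Type u) [BooleanAlgebra B] where
  arity : ℕ
  toFun : (Fin arity → B) → B
  isTerm : IsTermFunction toFun

/-- A term function is linear if it has the form `x_{i₁} + ⋯ + x_{iₘ} + c` with distinct variables
and `c ∈ {0, 1}`, computed in the Boolean ring of `B` (where `+` is symmetric difference). -/
def TermOp.IsLinear {B : Type u} [BooleanAlgebra B] (t : TermOp B) : Prop :=
  ∃ (s : Finset (Fin t.arity)) (c : AsBoolRing B), (c = 0 ∨ c = 1) ∧
    ∀ v, toBoolRing (t.toFun v) = ∑ i ∈ s, toBoolRing (v i) + c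

/-- A functional reduct `(B, t₁, …, tₖ)` of the Boolean algebra `B`: finitely many
term functions. -/
structure FunctionalReduct (B : Type u) [BooleanAlgebra B] where
  ops : List (TermOp B)

namespace FunctionalReduct

variable {B : Type u} [BooleanAlgebra B]

/-- The automorphism group of a functional reduct: the permutations of `B` that commute with
all of its operations. -/
def aut (R : FunctionalReduct B) : Subgroup (Equiv.Perm B) where
  carrier := {φ | ∀ t ∈ R.ops, ∀ v : Fin t.arity → B, φ (t.toFun v) = t.toFun (fun i => φ (v i))}
  one_mem' := fun _ _ _ => rfl
  mul_mem' := by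
    intro φ ψ hφ hψ t ht v
    simp only [Equiv.Perm.mul_apply]
    rw [hψ t ht v, hφ t ht]
  inv_mem' := by
    intro φ hφ t ht v
    rw [Equiv.Perm.inv_eq_iff_eq, hφ t ht]
    simp

/-- The functional first-order language of a functional reduct: one function symbol for each of
its operations. -/
def language (R : FunctionalReduct B) : FirstOrder.Language where
  Functions := fun n => {t : TermOp B // t ∈ R.ops ∧ t.arity = n}
  Relations := fun _ => Empty

/-- A functional reduct as a first-order structure on `B`. -/
instance instStructure (R : FunctionalReduct B) : R.language.Structure B where
  funMap := fun f v => f.1.toFun (fun i => v (Fin.cast f.2.2 i))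
  RelMap := fun r _ => r.elim

/-- All operations of `S` are first-order definable (without parameters) over `R`. -/
def Defines (R S : FunctionalReduct B) : Prop :=
  ∀ t ∈ S.ops, (∅ : Set B).DefinableFun R.language t.toFun

/-- First-order interdefinability of functional reducts. -/
def Interdefinable (R S : FunctionalReduct B) : Prop :=
  R.Defines S ∧ S.Defines R

end FunctionalReduct

section Operations

variable (B : Type u) [BooleanAlgebra B]

/-- The constant `0`. -/
def zeroOp : TermOp B := ⟨0, fun _ => ⊥, .bot⟩

/-- The constant `1`. -/
def oneOp : TermOp B := ⟨0, fun _ => ⊤, .top⟩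

/-- The identity `x`. -/
def idOp : TermOp B := ⟨1, fun v => v 0, .proj 0⟩

/-- The complement `¬x = x + 1`. -/
def negOp : TermOp B := ⟨1, fun v => (v 0)ᶜ, (IsTermFunction.proj 0).compl⟩

/-- `x + y`. -/
def addOp : TermOp B := ⟨2, fun v => v 0 ∆ v 1, (IsTermFunction.proj 0).add (.proj 1)⟩

/-- `x + y + 1`. -/
def addOneOp : TermOp B :=
  ⟨2, fun v => v 0 ∆ v 1 ∆ ⊤, ((IsTermFunction.proj 0).add (.proj 1)).add .top⟩

/-- `Σ(x, y, z) = x + y + z`. -/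
def sumOp : TermOp B :=
  ⟨3, fun v => v 0 ∆ v 1 ∆ v 2, ((IsTermFunction.proj 0).add (.proj 1)).add (.proj 2)⟩

/-- `Σ₁(x, y, z) = x + y + z + 1`. -/
def sumOneOp : TermOp B :=
  ⟨3, fun v => v 0 ∆ v 1 ∆ v 2 ∆ ⊤,
    (((IsTermFunction.proj 0).add (.proj 1)).add (.proj 2)).add .top⟩

/-- The median `M(x, y, z) = xy + yz + zx`. -/
def medianOp : TermOp B :=
  ⟨3, fun v => (v 0 ⊓ v 1) ∆ (v 1 ⊓ v 2) ∆ (v 2 ⊓ v 0),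
    (((IsTermFunction.proj 0).inf (.proj 1)).add ((IsTermFunction.proj 1).inf (.proj 2))).add
      ((IsTermFunction.proj 2).inf (.proj 0))⟩

/-- The meet `x ∧ y`. -/
def infOp : TermOp B := ⟨2, fun v => v 0 ⊓ v 1, (IsTermFunction.proj 0).inf (.proj 1)⟩

/-- The join `x ∨ y`. -/
def supOp : TermOp B := ⟨2, fun v => v 0 ⊔ v 1, (IsTermFunction.proj 0).sup (.proj 1)⟩

end Operations

/-- The thirteen nodes of the lattice of functional reducts. -/
inductive Node
  | ba
  | median
  | addZeroOne
  | negZeroOne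
  | zeroOne
  | add
  | addOne
  | sumOne
  | zero
  | one
  | sum
  | neg
  | id
  deriving DecidableEq

/-- The edges (covering pairs, lower node first) of the Hasse diagram of the lattice. -/
inductive Node.Edge : Node → Node → Prop
  | ba_median : Edge .ba .median
  | ba_addZeroOne : Edge .ba .addZeroOne
  | median_sumOne : Edge .median .sumOne
  | addZeroOne_negZeroOne : Edge .addZeroOne .negZeroOne
  | addZeroOne_add : Edge .addZeroOne .add
  | addZeroOne_addOne : Edge .addZeroOne .addOne
  | addZeroOne_sumOne : Edge .addZeroOne .sumOne
  | negZeroOne_zeroOne : Edge .negZeroOne .zeroOne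
  | negZeroOne_neg : Edge .negZeroOne .neg
  | zeroOne_zero : Edge .zeroOne .zero
  | zeroOne_one : Edge .zeroOne .one
  | add_zero : Edge .add .zero
  | add_sum : Edge .add .sum
  | addOne_one : Edge .addOne .one
  | addOne_sum : Edge .addOne .sum
  | sumOne_sum : Edge .sumOne .sum
  | sumOne_neg : Edge .sumOne .neg
  | zero_id : Edge .zero .id
  | one_id : Edge .one .id
  | sum_id : Edge .sum .id
  | neg_id : Edge .neg .id

/-- The order of the lattice: reachability in the Hasse diagram. -/
def Node.Below : Node → Node → Prop := Relation.ReflTransGen Node.Edge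

/-- The functional reduct sitting at each node. -/
def Node.reduct (B : Type u) [BooleanAlgebra B] : Node → FunctionalReduct B
  | .ba => ⟨[infOp B, supOp B, zeroOp B, oneOp B, negOp B]⟩
  | .median => ⟨[medianOp B]⟩
  | .addZeroOne => ⟨[addOp B, zeroOp B, oneOp B]⟩
  | .negZeroOne => ⟨[negOp B, zeroOp B, oneOp B]⟩
  | .zeroOne => ⟨[zeroOp B, oneOp B]⟩
  | .add => ⟨[addOp B]⟩
  | .addOne => ⟨[addOneOp B]⟩
  | .sumOne => ⟨[sumOneOp B]⟩
  | .zero => ⟨[zeroOp B]⟩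
  | .one => ⟨[oneOp B]⟩
  | .sum => ⟨[sumOp B]⟩
  | .neg => ⟨[negOp B]⟩
  | .id => ⟨[idOp B]⟩

end BooleanReduct

open BooleanReduct

/-! Every functional reduct is interdefinable with one generated by some of five features: the
constants 0 and 1, the complement, x+y+z and the median M. The defining formulas are explicit, so
equality of groups yields interdefinability without a Ryll-Nardzewski argument.

A linear operation x_1+...+x_m+c defines, and is defined by, features that depend only on m and c
(`defFun_iff_linearFeatures`). A non-linear operation has a nonzero mixed second difference.
Freezing all but two of its variables therefore gives a binary slice of the form (y+c)(z+b)+const.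
From such a slice one can read off the order of B translated by c. The median is the same in all
these translated orders, so quantifying the frozen parameters away leaves a definition of M
(`DefFun.median_of_not_isLinear`). Conversely, M defines every self-dual term function
(`TermOp.IsSelfDual.defFun`). A non-self-dual operation together with M yields a constant, and then
all term functions.

The features obey a few closure rules: with the complement, 0 and 1 define each other; x+y+z with 0
and 1 gives the complement; M gives the complement and x+y+z. The sets closed under these rules are
the feature sets of the 13 nodes.

To show that the 13 groups are distinct and ordered as claimed, it suffices to treat the pairs of a
feature and a maximal closed set omitting it. For each pair some permutation preserves the set and
violates the feature: the complement, a transvection x + l(x)a, or a transposition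
(`exists_aut_of_features_eq_false`). Atomlessness enters only through a chain 0 < b < a < 1.

Identities in B are checked under all homomorphisms to the two-element algebra, where they become
finite truth tables. -/

namespace BooleanReduct

universe u

open FirstOrder FirstOrder.Language

/-! ### Calculus of parameter-free definability -/

section Calculus

variable {L : FirstOrder.Language} {M : Type*} [L.Structure M] {α β : Type*}

/-- A predicate on tuples is definable without parameters. -/
def DefPred (L : FirstOrder.Language) {M : Type*} [L.Structure M] {α : Type*}
    (P : (α → M) → Prop) : Prop :=
  (∅ : Set M).Definable L {v | P v}

/-- A function on tuples is definable without parameters. -/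
def DefFun (L : FirstOrder.Language) {M : Type*} [L.Structure M] {α : Type*}
    (f : (α → M) → M) : Prop :=
  (∅ : Set M).DefinableFun L f

theorem DefPred.congr {P Q : (α → M) → Prop} (h : DefPred L P) (e : ∀ v, Q v ↔ P v) :
    DefPred L Q := by
  have : Q = P := funext fun v => propext (e v)
  rwa [this]

theorem DefPred.false : DefPred L (fun _ : α → M => False) :=
  Set.definable_empty

theorem DefPred.and {P Q : (α → M) → Prop} (hP : DefPred L P) (hQ : DefPred L Q) :
    DefPred L (fun v => P v ∧ Q v) :=
  Set.Definable.inter hP hQ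

theorem DefPred.not {P : (α → M) → Prop} (hP : DefPred L P) : DefPred L (fun v => ¬ P v) :=
  Set.Definable.compl hP

theorem DefPred.imp {P Q : (α → M) → Prop} (hP : DefPred L P) (hQ : DefPred L Q) :
    DefPred L (fun v => P v → Q v) :=
  (hP.and hQ.not).not.congr fun v => by tauto

theorem DefPred.eq {f g : (α → M) → M} (hf : DefFun L f) (hg : DefFun L g) :
    DefPred L (fun v => f v = g v) :=
  Set.DefinableFun.ofPred_eq hf hg

theorem DefPred.comp [Finite β] {P : (β → M) → Prop} (hP : DefPred L P)
    {F : (α → M) → β → M} (hF : ∀ i, DefFun L fun v => F v i) : DefPred L (fun v => P (F v)) :=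
  Set.Definable.preimage_map (F := F) hF hP

theorem DefPred.all_tuple [Finite β] {P : (α → M) → (β → M) → Prop}
    (h : DefPred L (fun w : α ⊕ β → M => P (fun i => w (.inl i)) (fun i => w (.inr i)))) :
    DefPred L (fun v => ∀ u : β → M, P v u) :=
  Set.Definable.forall_of_finite h

theorem DefPred.ex_tuple [Finite β] {P : (α → M) → (β → M) → Prop}
    (h : DefPred L (fun w : α ⊕ β → M => P (fun i => w (.inl i)) (fun i => w (.inr i)))) :
    DefPred L (fun v => ∃ u : β → M, P v u) :=
  Set.Definable.exists_of_finite h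

theorem DefPred.all {P : (α → M) → M → Prop}
    (h : DefPred L (fun w : α ⊕ Unit → M => P (fun i => w (.inl i)) (w (.inr ())))) :
    DefPred L (fun v => ∀ x : M, P v x) :=
  (DefPred.all_tuple (P := fun v u => P v (u ())) h).congr fun _ =>
    ⟨fun H u => H (u ()), fun H x => H fun _ => x⟩

theorem DefPred.ex {P : (α → M) → M → Prop}
    (h : DefPred L (fun w : α ⊕ Unit → M => P (fun i => w (.inl i)) (w (.inr ())))) :
    DefPred L (fun v => ∃ x : M, P v x) :=
  (DefPred.ex_tuple (P := fun v u => P v (u ())) h).congr fun _ =>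
    ⟨fun ⟨x, hx⟩ => ⟨fun _ => x, hx⟩, fun ⟨u, hu⟩ => ⟨u (), hu⟩⟩

theorem DefFun.var (i : α) : DefFun L (fun v : α → M => v i) :=
  L.definableFun_var i

theorem DefFun.of_graph {f : (α → M) → M}
    (h : DefPred L (fun w : Option α → M => f (fun i => w (some i)) = w none)) : DefFun L f :=
  h

theorem DefFun.of_graph_iff {f : (α → M) → M} {P : (Option α → M) → Prop} (hP : DefPred L P)
    (h : ∀ w : Option α → M, f (fun i => w (some i)) = w none ↔ P w) : DefFun L f :=
  DefFun.of_graph (hP.congr h)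

theorem DefFun.comp [Finite β] {f : (β → M) → M} (hf : DefFun L f)
    {F : (α → M) → β → M} (hF : ∀ i, DefFun L fun v => F v i) : DefFun L (fun v => f (F v)) :=
  Set.DefinableFun.comp (g := F) hF hf

theorem DefFun.reindex {f : (α → M) → M} (hf : DefFun L f) (e : α → β) :
    DefFun L (fun v : β → M => f fun i => v (e i)) :=
  DefFun.of_graph (Set.Definable.preimage_comp (fun o : Option α => o.map e) hf |> fun h =>
    DefPred.congr h fun _ => Iff.rfl)

theorem DefFun.lift {f : (α → M) → M} (hf : DefFun L f) :
    DefFun L fun v : α ⊕ β → M => f fun i => v (Sum.inl i) :=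
  hf.reindex Sum.inl

theorem DefFun.congr {f g : (α → M) → M} (hf : DefFun L f) (e : ∀ v, g v = f v) : DefFun L g := by
  rwa [show g = f from funext e]

variable {L' : FirstOrder.Language} [L'.Structure M]

/-- If all symbols of one language are definable over another one, so are all terms. -/
theorem DefFun.realize_term
    (hF : ∀ {n} (f : L'.Functions n), DefFun L (Structure.funMap f : (Fin n → M) → M))
    (t : L'.Term α) : DefFun L (fun v : α → M => t.realize v) := by
  induction t with
  | var i => exact DefFun.var i
  | func f ts ih => exact (hF f).comp ih

/-- If all symbols of one language are definable over another one, so are all formulas. -/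
theorem DefPred.realize_boundedFormula
    (hF : ∀ {n} (f : L'.Functions n), DefFun L (Structure.funMap f : (Fin n → M) → M))
    (hR : ∀ {n} (r : L'.Relations n), DefPred L (Structure.RelMap r : (Fin n → M) → Prop))
    {n : ℕ} (φ : L'.BoundedFormula α n) :
    DefPred L (fun v : α ⊕ Fin n → M => φ.Realize (fun i => v (.inl i)) (fun i => v (.inr i))) := by
  have hv : ∀ {m : ℕ} (v : α ⊕ Fin m → M),
      Sum.elim (fun i => v (.inl i)) (fun i => v (.inr i)) = v := fun v => by
    ext x; cases x <;> rfl
  induction φ with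
  | falsum => exact DefPred.false
  | equal t₁ t₂ =>
    refine (DefPred.eq (DefFun.realize_term hF t₁) (DefFun.realize_term hF t₂)).congr fun v => ?_
    simp only [BoundedFormula.Realize, hv]
  | rel r ts =>
    refine (DefPred.comp (hR r) fun i => DefFun.realize_term hF (ts i)).congr fun v => ?_
    simp only [BoundedFormula.Realize, hv]
  | imp φ ψ hφ hψ => exact hφ.imp hψ
  | @all k φ ih =>
    refine DefPred.all ?_
    -- The variable bound by the quantifier is the last of the `k + 1` de Bruijn variables; `e`
    -- splits it off.
    let e : α ⊕ Fin (k + 1) → (α ⊕ Fin k) ⊕ Unit :=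
      Sum.elim (fun a => .inl (.inl a)) (Fin.lastCases (.inr ()) fun i => .inl (.inr i))
    refine DefPred.congr (Set.Definable.preimage_comp e ih) fun w => ?_
    refine iff_of_eq ?_
    change φ.Realize _ _ = φ.Realize _ _
    congr 1
    ext i
    induction i using Fin.lastCases <;> simp [e]

/-- In the formula defining the graph, each symbol of `L'` can be replaced by its definition over
`L`. -/
theorem DefFun.trans
    (hF : ∀ {n} (f : L'.Functions n), DefFun L (Structure.funMap f : (Fin n → M) → M))
    (hR : ∀ {n} (r : L'.Relations n), DefPred L (Structure.RelMap r : (Fin n → M) → Prop))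
    {f : (α → M) → M} (h : DefFun L' f) : DefFun L f := by
  obtain ⟨φ, hφ⟩ := Set.empty_definableFun_iff.1 h
  let e : Option α ⊕ Fin 0 → Option α := Sum.elim id Fin.elim0
  refine DefFun.of_graph_iff
    (Set.Definable.preimage_comp e (DefPred.realize_boundedFormula hF hR φ)) fun w => ?_
  have h1 := Set.ext_iff.1 hφ w
  refine Iff.trans h1 (iff_of_eq ?_)
  change φ.Realize w = BoundedFormula.Realize φ _ _
  rw [Formula.Realize]
  congr 1
  exact Subsingleton.elim _ _

end Calculus

/-! ### Definability between reducts and automorphism groups -/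

namespace FunctionalReduct

variable {B : Type u} [BooleanAlgebra B] {R S T : FunctionalReduct B}

theorem defFun_of_mem {t : TermOp B} (ht : t ∈ R.ops) : DefFun R.language t.toFun :=
  Set.DefinableFun.fun_symbol (L := R.language) (n := t.arity) ⟨t, ht, rfl⟩

theorem Defines.trans_defFun (h : R.Defines S) {α : Type*} {f : (α → B) → B}
    (hf : DefFun S.language f) : DefFun R.language f := by
  refine DefFun.trans (L' := S.language) ?_ (fun r => r.elim) hf
  rintro n ⟨t, ht, rfl⟩
  exact h t ht

theorem Defines.refl (R : FunctionalReduct B) : R.Defines R := fun _ => defFun_of_mem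

theorem Defines.trans (h : R.Defines S) (h' : S.Defines T) : R.Defines T :=
  fun t ht => h.trans_defFun (h' t ht)

/-- An automorphism of the first-order structure of `R` preserves every formula, in particular those
defining the graphs of the operations of `S`. -/
theorem Defines.aut_le (h : R.Defines S) : R.aut ≤ S.aut := by
  intro φ hφ t ht v
  let g : B ≃[R.language] B :=
    { toEquiv := φ
      map_fun' := fun f v => hφ f.1 f.2.1 _
      map_rel' := fun r => r.elim }
  obtain ⟨ψ, hψ⟩ := Set.empty_definableFun_iff.1 (h t ht)
  have key : ∀ w : Option (Fin t.arity) → B,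
      t.toFun (fun i => w (some i)) = w none ↔ ψ.Realize w := fun w => Set.ext_iff.1 hψ w
  let w : Option (Fin t.arity) → B := fun o => o.elim (t.toFun v) v
  have h1 : ψ.Realize w := (key w).1 rfl
  have h2 := (key (g ∘ w)).2 ((StrongHomClass.realize_formula g ψ).2 h1)
  exact h2.symm

theorem Interdefinable.aut_eq (h : R.Interdefinable S) : R.aut = S.aut :=
  le_antisymm h.1.aut_le h.2.aut_le

theorem Interdefinable.symm (h : R.Interdefinable S) : S.Interdefinable R := ⟨h.2, h.1⟩

theorem Interdefinable.trans (h : R.Interdefinable S) (h' : S.Interdefinable T) :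
    R.Interdefinable T := ⟨h.1.trans h'.1, h'.2.trans h.2⟩

end FunctionalReduct

/-! ### Two-valued homomorphisms and pointwise verification -/

section Characters

variable {B : Type*} [BooleanAlgebra B]

/-- The two-valued homomorphisms of a Boolean algebra. -/
abbrev Character (B : Type*) [BooleanAlgebra B] := BoundedLatticeHom B Bool

/-- The prime ideal theorem separates the filter generated by `b` from the zero ideal; the character
is the indicator of the complement of the resulting prime ideal. -/
theorem exists_character {b : B} (hb : b ≠ ⊥) : ∃ χ : Character B, χ b = true := by
  classical
  have hdis : Disjoint ((Order.PFilter.principal b : Order.PFilter B) : Set B)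
      ((Order.Ideal.principal (⊥ : B) : Order.Ideal B) : Set B) := by
    rw [Set.disjoint_left]
    intro x hx hx'
    have h1 : b ≤ x := Order.PFilter.mem_principal.1 hx
    have h2 : x ≤ ⊥ := Order.Ideal.mem_principal.1 hx'
    exact hb (le_bot_iff.1 (h1.trans h2))
  obtain ⟨J, hJ, -, hd⟩ := DistribLattice.prime_ideal_of_disjoint_filter_ideal hdis
  have hbJ : b ∉ J := Set.disjoint_left.1 hd (Order.PFilter.mem_principal.2 le_rfl)
  have htop : (⊤ : B) ∉ J := fun h => hbJ (J.lower le_top h)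
  refine ⟨{ toFun := fun x => decide (x ∉ J)
            map_sup' := fun x y => ?_
            map_inf' := fun x y => ?_
            map_top' := by simpa using htop
            map_bot' := by simp }, by simpa using hbJ⟩
  · by_cases hx : x ∈ J <;> by_cases hy : y ∈ J <;> simp [hx, hy]
  · by_cases hx : x ∈ J
    · have : x ⊓ y ∈ J := J.lower inf_le_left hx
      simp [hx, this]
    · by_cases hy : y ∈ J
      · have : x ⊓ y ∈ J := J.lower inf_le_right hy
        simp [hy, this]
      · have : x ⊓ y ∉ J := fun h => (hJ.mem_or_mem h).elim hx hy
        simp [hx, hy, this]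

theorem Character.map_symmDiff (χ : Character B) (x y : B) : χ (x ∆ y) = (χ x ^^ χ y) := by
  rw [map_symmDiff', Bool.symmDiff_eq_xor]

theorem Character.map_inf (χ : Character B) (x y : B) : χ (x ⊓ y) = (χ x && χ y) :=
  InfHomClass.map_inf χ x y

theorem Character.map_sup (χ : Character B) (x y : B) : χ (x ⊔ y) = (χ x || χ y) :=
  SupHomClass.map_sup χ x y

theorem Character.map_compl (χ : Character B) (x : B) : χ xᶜ = !χ x :=
  map_compl' χ x

theorem Character.map_bot (χ : Character B) : χ ⊥ = false := BotHomClass.map_bot χ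

theorem Character.map_top (χ : Character B) : χ ⊤ = true := TopHomClass.map_top χ

/-- A nonzero difference `x ∆ y` would be detected by some character. This reduces every identity in
B to a truth table. -/
theorem eq_of_characters {x y : B} (h : ∀ χ : Character B, χ x = χ y) : x = y := by
  by_contra hne
  obtain ⟨χ, hχ⟩ := exists_character (b := x ∆ y) (by simpa using hne)
  rw [χ.map_symmDiff, h χ] at hχ
  simp at hχ

theorem le_iff_characters {x y : B} : x ≤ y ↔ ∀ χ : Character B, χ x = true → χ y = true := by
  constructor
  · intro h χ hx
    have := χ.map_inf x y
    rw [inf_eq_left.2 h, hx] at this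
    simpa using this.symm
  · intro h
    rw [← inf_eq_left]
    refine eq_of_characters fun χ => ?_
    rw [χ.map_inf]
    cases hx : χ x
    · rfl
    · simp [h χ hx]

/-- The element `0` or `1` with a given truth value. -/
def ofBool (b : Bool) : B := if b then ⊤ else ⊥

theorem Character.map_ofBool (χ : Character B) (b : Bool) : χ (ofBool b) = b := by
  cases b <;> simp [ofBool]

/-- A term function is computed pointwise by a Boolean function. -/
theorem IsTermFunction.exists_bool {n : ℕ} {f : (Fin n → B) → B} (hf : IsTermFunction f) :
    ∃ F : (Fin n → Bool) → Bool,
      ∀ (χ : Character B) (v : Fin n → B), χ (f v) = F (fun i => χ (v i)) := by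
  induction hf with
  | proj i => exact ⟨fun x => x i, fun _ _ => rfl⟩
  | bot => exact ⟨fun _ => false, fun χ _ => χ.map_bot⟩
  | top => exact ⟨fun _ => true, fun χ _ => χ.map_top⟩
  | compl _ ih =>
    obtain ⟨F, hF⟩ := ih
    exact ⟨fun x => !F x, fun χ v => by rw [χ.map_compl, hF]⟩
  | inf _ _ ihf ihg =>
    obtain ⟨F, hF⟩ := ihf
    obtain ⟨G, hG⟩ := ihg
    exact ⟨fun x => F x && G x, fun χ v => by rw [χ.map_inf, hF, hG]⟩
  | sup _ _ ihf ihg =>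
    obtain ⟨F, hF⟩ := ihf
    obtain ⟨G, hG⟩ := ihg
    exact ⟨fun x => F x || G x, fun χ v => by rw [χ.map_sup, hF, hG]⟩

end Characters

/-! ### Linearity through second differences -/

section MixedDifference

/-- The mixed second difference of a Boolean function in two coordinates. -/
def mixedDiff {n : ℕ} (F : (Fin n → Bool) → Bool) (i j : Fin n) (x : Fin n → Bool) : Bool :=
  (F (Function.update (Function.update x i false) j false) ^^
    F (Function.update (Function.update x i false) j true)) ^^
  (F (Function.update (Function.update x i true) j false) ^^
    F (Function.update (Function.update x i true) j true))

/-- A vanishing mixed difference says that the derivative in direction `a` is unaffected by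
switching another coordinate `j`; switching on the elements of `S` one by one thus leaves it at its
value at the origin. -/
theorem apply_insert_of_mixedDiff_eq_false {n : ℕ} {F : (Fin n → Bool) → Bool}
    (h : ∀ i j x, i ≠ j → mixedDiff F i j x = false) (a : Fin n) (S : Finset (Fin n)) (ha : a ∉ S) :
    (F (fun i => decide (i ∈ insert a S)) ^^ F (fun i => decide (i ∈ S))) =
      (F (fun i => decide (i = a)) ^^ F (fun _ => false)) := by
  induction S using Finset.induction_on with
  | empty => simp
  | insert j S hj ih =>
    have haj : a ≠ j := fun e => ha (by simp [e])
    have haS : a ∉ S := fun e => ha (by simp [e])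
    rw [← ih haS]
    have key := h a j (fun i => decide (i ∈ S)) haj
    have e1 : Function.update (Function.update (fun i => decide (i ∈ S)) a false) j false =
        fun i => decide (i ∈ S) := by
      ext i; by_cases h1 : i = j <;> by_cases h2 : i = a <;> simp_all [Function.update]
    have e2 : Function.update (Function.update (fun i => decide (i ∈ S)) a false) j true =
        fun i => decide (i ∈ insert j S) := by
      ext i; by_cases h1 : i = j <;> by_cases h2 : i = a <;> simp_all [Function.update]
    have e3 : Function.update (Function.update (fun i => decide (i ∈ S)) a true) j false =
        fun i => decide (i ∈ insert a S) := by
      ext i; by_cases h1 : i = j <;> by_cases h2 : i = a <;> simp_all [Function.update]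
    have e4 : Function.update (Function.update (fun i => decide (i ∈ S)) a true) j true =
        fun i => decide (i ∈ insert a (insert j S)) := by
      ext i; by_cases h1 : i = j <;> by_cases h2 : i = a <;> simp_all [Function.update]
    rw [mixedDiff, e1, e2, e3, e4] at key
    generalize F (fun i => decide (i ∈ insert a (insert j S))) = p at key ⊢
    generalize F (fun i => decide (i ∈ insert j S)) = q at key ⊢
    generalize F (fun i => decide (i ∈ insert a S)) = r at key ⊢
    generalize F (fun i => decide (i ∈ S)) = s at key ⊢
    revert p q r s
    decide

variable {B : Type*} [BooleanAlgebra B]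

/-- A term operation whose mixed second differences all vanish is linear. -/
theorem TermOp.isLinear_of_mixedDiff {t : TermOp B} {F : (Fin t.arity → Bool) → Bool}
    (hF : ∀ (χ : Character B) v, χ (t.toFun v) = F (fun i => χ (v i)))
    (h : ∀ i j x, i ≠ j → mixedDiff F i j x = false) : t.IsLinear := by
  classical
  -- The variables that occur are those in whose direction the derivative at the origin is 1; the
  -- constant term will be the value at the origin.
  let s : Finset (Fin t.arity) :=
    Finset.univ.filter fun a => (F (fun i => decide (i = a)) ^^ F (fun _ => false)) = true
  have key : ∀ S : Finset (Fin t.arity), toBoolRing (F fun i => decide (i ∈ S)) =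
      ∑ i ∈ s, toBoolRing (decide (i ∈ S)) + toBoolRing (F fun _ => false) := by
    intro S
    induction S using Finset.induction_on with
    | empty =>
      have : toBoolRing false = 0 := toBoolRing_bot
      simp [this]
    | insert a S ha ih =>
      have h1 := apply_insert_of_mixedDiff_eq_false h a S ha
      have h2 : F (fun i => decide (i ∈ insert a S)) =
          (F fun i => decide (i ∈ S)) ∆ (F (fun i => decide (i = a)) ^^ F (fun _ => false)) := by
        rw [Bool.symmDiff_eq_xor, ← h1]
        generalize F (fun i => decide (i ∈ insert a S)) = p
        generalize F (fun i => decide (i ∈ S)) = q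
        revert p q; decide
      have h3 : ∀ i, toBoolRing (decide (i ∈ insert a S)) =
          toBoolRing (decide (i ∈ S)) + if i = a then 1 else 0 := by
        intro i
        have h0 : toBoolRing false = 0 := toBoolRing_bot
        have ht : toBoolRing true = (1 : AsBoolRing Bool) := toBoolRing_top
        by_cases hi : i = a
        · subst hi; simpa [ha, h0] using ht
        · simp [hi]
      rw [h2, toBoolRing_symmDiff, ih, Finset.sum_congr rfl fun i _ => h3 i,
        Finset.sum_add_distrib, Finset.sum_ite_eq' s a]
      have h4 : toBoolRing (F (fun i => decide (i = a)) ^^ F (fun _ => false)) =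
          if a ∈ s then 1 else 0 := by
        simp only [s, Finset.mem_filter, Finset.mem_univ, true_and]
        split_ifs with hh
        · rw [hh]; exact toBoolRing_top
        · rw [Bool.not_eq_true] at hh
          rw [hh]; exact toBoolRing_bot
      rw [h4]; abel
  refine ⟨s, toBoolRing (ofBool (F fun _ => false)), ?_, fun v => ?_⟩
  · cases F fun _ => false
    · exact Or.inl (by simp [ofBool])
    · exact Or.inr (by simp [ofBool])
  · apply ofBoolRing.injective
    refine eq_of_characters fun χ => ?_
    have hL : χ (ofBoolRing (toBoolRing (t.toFun v))) = F fun i => χ (v i) := hF χ v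
    have hS : (fun i => χ (v i)) =
        fun i => decide (i ∈ Finset.univ.filter fun i => χ (v i) = true) := by
      ext i; simp
    have hR : χ.asBoolRing (∑ i ∈ s, toBoolRing (v i) + toBoolRing (ofBool (F fun _ => false))) =
        ∑ i ∈ s, toBoolRing (χ (v i)) + toBoolRing (F fun _ => false) := by
      rw [map_add, map_sum]
      congr 1
      exact congrArg toBoolRing (χ.map_ofBool _)
    have hK := key (Finset.univ.filter fun i => χ (v i) = true)
    rw [← hS] at hK
    rw [hL]
    have h5 : toBoolRing (F fun i => χ (v i)) = χ.asBoolRing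
        (∑ i ∈ s, toBoolRing (v i) + toBoolRing (ofBool (F fun _ => false))) := by
      rw [hR, hK]
      congr 1
      refine Finset.sum_congr rfl fun i _ => ?_
      rw [← congrFun hS i]
    exact congrArg ofBoolRing h5

end MixedDifference

/-! ### Reading a translated order off a non-linear slice -/

section Slices

variable {B : Type u} [BooleanAlgebra B] {n : ℕ} (f : (Fin n → B) → B) (i j : Fin n)

/-- The binary operation obtained from `f` by freezing all coordinates except `i` and `j`. -/
def slice (p : Fin n → B) (y z : B) : B :=
  f (Function.update (Function.update p i y) j z)

/-- Freezing also the coordinate `i` to `y` leaves a constant operation. -/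
def SliceConst (p : Fin n → B) (y : B) : Prop :=
  ∀ z z', slice f i j p y z = slice f i j p y z'

/-- `c` is the only value at which the slice is constant. -/
def IsSliceZero (p : Fin n → B) (c : B) : Prop :=
  SliceConst f i j p c ∧ ∀ y, SliceConst f i j p y → y = c

/-- The order of `B` translated by `c`, read off from a slice. -/
def SliceLE (p : Fin n → B) (c u v : B) : Prop :=
  ∀ z, slice f i j p v z = slice f i j p c z → slice f i j p u z = slice f i j p c z

/-- `w` is the median of `x`, `y`, `z` in the order read off from a slice. -/
def IsSliceMedian (p : Fin n → B) (c x y z w : B) : Prop :=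
  ((∀ s, SliceLE f i j p c s x → SliceLE f i j p c s y → SliceLE f i j p c s w) ∧
   (∀ s, SliceLE f i j p c s y → SliceLE f i j p c s z → SliceLE f i j p c s w) ∧
   (∀ s, SliceLE f i j p c s z → SliceLE f i j p c s x → SliceLE f i j p c s w)) ∧
  ((∀ s, SliceLE f i j p c x s → SliceLE f i j p c y s → SliceLE f i j p c w s) ∧
   (∀ s, SliceLE f i j p c y s → SliceLE f i j p c z s → SliceLE f i j p c w s) ∧
   (∀ s, SliceLE f i j p c z s → SliceLE f i j p c x s → SliceLE f i j p c w s))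

variable {f i j} {F : (Fin n → Bool) → Bool}

theorem map_slice
    (hF : ∀ (χ : Character B) v, χ (f v) = F (fun k => χ (v k)))
    (χ : Character B) (p : Fin n → B) (y z : B) :
    χ (slice f i j p y z) =
      F (Function.update (Function.update (fun k => χ (p k)) i (χ y)) j (χ z)) := by
  rw [slice, hF]
  congr 1
  ext k
  by_cases hj : k = j
  · subst hj; simp
  · by_cases hi : k = i
    · subst hi; simp [hj]
    · simp [hi, hj]

/-- At a Boolean point where the mixed difference is 1, the slice is (y+c)(z+b)+const, which is
independent of z exactly when y = c. The coefficient c of z is the sum of the values at (0,0) and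
(0,1). -/
theorem exists_isSliceZero
    (hF : ∀ (χ : Character B) v, χ (f v) = F (fun k => χ (v k)))
    {x : Fin n → Bool} (hx : mixedDiff F i j x = true) :
    ∃ (p : Fin n → B) (c : B), IsSliceZero f i j p c := by
  refine ⟨fun k => ofBool (x k), ofBool
    (F (Function.update (Function.update x i false) j false) ^^
      F (Function.update (Function.update x i false) j true)), fun z z' => ?_, fun y hy => ?_⟩
  · refine eq_of_characters fun χ => ?_
    simp only [map_slice hF, χ.map_ofBool]
    unfold mixedDiff at hx
    generalize h00 : F (Function.update (Function.update x i false) j false) = a at *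
    generalize h01 : F (Function.update (Function.update x i false) j true) = b at *
    generalize h10 : F (Function.update (Function.update x i true) j false) = c at *
    generalize h11 : F (Function.update (Function.update x i true) j true) = d at *
    generalize χ z = s
    generalize χ z' = s'
    cases a <;> cases b <;> cases c <;> cases d <;> cases s <;> cases s' <;> simp_all
  · refine eq_of_characters fun χ => ?_
    have h := congrArg χ (hy ⊥ ⊤)
    simp only [map_slice hF, χ.map_ofBool, χ.map_bot, χ.map_top] at h
    rw [χ.map_ofBool]
    unfold mixedDiff at hx
    generalize h00 : F (Function.update (Function.update x i false) j false) = a at *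
    generalize h01 : F (Function.update (Function.update x i false) j true) = b at *
    generalize h10 : F (Function.update (Function.update x i true) j false) = c at *
    generalize h11 : F (Function.update (Function.update x i true) j true) = d at *
    generalize χ y = s at *
    cases a <;> cases b <;> cases c <;> cases d <;> cases s <;> simp_all

variable {p : Fin n → B} {c : B}

/-- If the slice has a zero, the slice is non-linear at every point. -/
theorem IsSliceZero.mixedDiff
    (hF : ∀ (χ : Character B) v, χ (f v) = F (fun k => χ (v k)))
    (h : IsSliceZero f i j p c) (χ : Character B) :
    mixedDiff F i j (fun k => χ (p k)) = true := by
  let d : B := (slice f i j p ⊥ ⊥ ∆ slice f i j p ⊥ ⊤) ∆ (slice f i j p ⊤ ⊥ ∆ slice f i j p ⊤ ⊤)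
  have hd : ∀ ψ : Character B, ψ d = BooleanReduct.mixedDiff F i j (fun k => ψ (p k)) := by
    intro ψ
    simp only [d, ψ.map_symmDiff, map_slice hF, ψ.map_bot, ψ.map_top, BooleanReduct.mixedDiff]
  -- Where the mixed difference `d` vanishes, the slice is affine without product term, so if it is
  -- independent of z at `c` it is so for every y. Flipping `c` there gives another zero, and
  -- uniqueness forces `d` to be 1.
  have hc : SliceConst f i j p (c ∆ dᶜ) := by
    intro z z'
    refine eq_of_characters fun ψ => ?_
    have h1 := congrArg ψ (h.1 ⊥ ⊤)
    have h2 := hd ψ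
    simp only [map_slice hF, ψ.map_symmDiff, ψ.map_compl, ψ.map_bot, ψ.map_top,
      BooleanReduct.mixedDiff] at h1 h2 ⊢
    generalize ψ d = e at *
    generalize ψ c = c' at *
    generalize (fun k => ψ (p k)) = x at *
    generalize h00 : F (Function.update (Function.update x i false) j false) = a at *
    generalize h01 : F (Function.update (Function.update x i false) j true) = b at *
    generalize h10 : F (Function.update (Function.update x i true) j false) = c at *
    generalize h11 : F (Function.update (Function.update x i true) j true) = d at *
    generalize ψ z = s
    generalize ψ z' = s'
    subst h2
    cases a <;> cases b <;> cases c <;> cases d <;> cases s <;> cases s' <;> cases c' <;> simp_all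
  have h3 := congrArg χ (h.2 _ hc)
  rw [← hd χ]
  rw [χ.map_symmDiff, χ.map_compl] at h3
  generalize χ d = e at *
  generalize χ c = c' at *
  revert e c'
  decide

/-- The slices at v and c differ by (v+c)(z+b), so the relation says that every z+b annihilating v+c
annihilates u+c. -/
theorem IsSliceZero.sliceLE_iff
    (hF : ∀ (χ : Character B) v, χ (f v) = F (fun k => χ (v k)))
    (h : IsSliceZero f i j p c) {u v : B} :
    SliceLE f i j p c u v ↔ u ∆ c ≤ v ∆ c := by
  rw [le_iff_characters]
  constructor
  · intro hle χ
    -- This is the b of (y+c)(z+b)+const: the difference in y at z = 1 is 1+b.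
    let b : B := (slice f i j p ⊥ ⊤ ∆ slice f i j p ⊤ ⊤)ᶜ
    have hb : ∀ ψ : Character B, ψ b =
        !(F (Function.update (Function.update (fun k => ψ (p k)) i false) j true) ^^
          F (Function.update (Function.update (fun k => ψ (p k)) i true) j true)) := by
      intro ψ
      simp only [b, ψ.map_compl, ψ.map_symmDiff, map_slice hF, ψ.map_bot, ψ.map_top]
    -- This z makes z+b the complement of v+c, the largest annihilator of v+c.
    have hz : slice f i j p v (b ∆ (v ∆ c)ᶜ) = slice f i j p c (b ∆ (v ∆ c)ᶜ) := by
      refine eq_of_characters fun ψ => ?_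
      have h1 := h.mixedDiff hF ψ
      have h2 := hb ψ
      simp only [map_slice hF, ψ.map_symmDiff, ψ.map_compl, BooleanReduct.mixedDiff] at h1 ⊢
      generalize ψ b = e at *
      generalize ψ c = c' at *
      generalize ψ v = v' at *
      generalize (fun k => ψ (p k)) = x at *
      generalize h00 : F (Function.update (Function.update x i false) j false) = a at *
      generalize h01 : F (Function.update (Function.update x i false) j true) = b at *
      generalize h10 : F (Function.update (Function.update x i true) j false) = c at *
      generalize h11 : F (Function.update (Function.update x i true) j true) = d at *
      subst h2
      cases a <;> cases b <;> cases c <;> cases d <;> cases v' <;> cases c' <;> simp_all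
    have h3 := congrArg χ (hle _ hz)
    have h1 := h.mixedDiff hF χ
    have h2 := hb χ
    simp only [map_slice hF, χ.map_symmDiff, χ.map_compl, BooleanReduct.mixedDiff] at h1 h3 ⊢
    generalize χ b = e at *
    generalize χ c = c' at *
    generalize χ v = v' at *
    generalize χ u = u' at *
    generalize (fun k => χ (p k)) = x at *
    generalize h00 : F (Function.update (Function.update x i false) j false) = a at *
    generalize h01 : F (Function.update (Function.update x i false) j true) = b at *
    generalize h10 : F (Function.update (Function.update x i true) j false) = c at *
    generalize h11 : F (Function.update (Function.update x i true) j true) = d at *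
    subst h2
    cases a <;> cases b <;> cases c <;> cases d <;> cases v' <;> cases c' <;> cases u' <;>
      simp_all
  · intro hle z hz
    refine eq_of_characters fun χ => ?_
    have h1 := hle χ
    have h2 := congrArg χ hz
    rw [χ.map_symmDiff, χ.map_symmDiff] at h1
    rw [map_slice hF, map_slice hF] at h2 ⊢
    generalize χ u = u' at *
    generalize χ v = v' at *
    generalize χ c = c' at *
    cases u' <;> cases v' <;> cases c' <;> simp_all

end Slices

/-! ### Definability of the slice relations -/

section SliceDefinability

variable {B : Type u} {L : FirstOrder.Language} [L.Structure B] {α : Type*}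
  {n : ℕ} {f : (Fin n → B) → B}

theorem DefFun.slice (hf : DefFun L f) (i j : Fin n) {p : (α → B) → Fin n → B} {y z : (α → B) → B}
    (hp : ∀ k, DefFun L fun v => p v k) (hy : DefFun L y) (hz : DefFun L z) :
    DefFun L fun v => slice f i j (p v) (y v) (z v) := by
  refine DefFun.comp hf (F := fun v => Function.update (Function.update (p v) i (y v)) j (z v))
    fun k => ?_
  by_cases hj : k = j
  · subst hj; simpa using hz
  · by_cases hi : k = i
    · subst hi; simpa [hj] using hy
    · simpa [hi, hj] using hp k

theorem DefPred.isSliceZero (hf : DefFun L f) (i j : Fin n) {p : (α → B) → Fin n → B}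
    {c : (α → B) → B} (hp : ∀ k, DefFun L fun v => p v k) (hc : DefFun L c) :
    DefPred L fun v => IsSliceZero f i j (p v) (c v) := by
  have key : ∀ {γ : Type _} {p : (γ → B) → Fin n → B} {y : (γ → B) → B},
      (∀ k, DefFun L fun v => p v k) → DefFun L y →
      DefPred L fun v => SliceConst f i j (p v) (y v) := fun hp hy =>
    DefPred.all <| DefPred.all <| DefPred.eq
      (DefFun.slice hf i j (fun k => (hp k).lift.lift) hy.lift.lift (DefFun.var (Sum.inl (Sum.inr ()))))
      (DefFun.slice hf i j (fun k => (hp k).lift.lift) hy.lift.lift (DefFun.var (Sum.inr ())))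
  exact (key hp hc).and <| DefPred.all <|
    (key (fun k => (hp k).lift) (DefFun.var (Sum.inr ()))).imp (DefPred.eq (DefFun.var (Sum.inr ())) hc.lift)

theorem DefPred.sliceLE (hf : DefFun L f) (i j : Fin n) {p : (α → B) → Fin n → B}
    {c u v : (α → B) → B} (hp : ∀ k, DefFun L fun v => p v k) (hc : DefFun L c) (hu : DefFun L u)
    (hv : DefFun L v) : DefPred L fun x => SliceLE f i j (p x) (c x) (u x) (v x) :=
  DefPred.all <| DefPred.imp
    (DefPred.eq
      (DefFun.slice hf i j (fun k => (hp k).lift) hv.lift (DefFun.var (Sum.inr ())))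
      (DefFun.slice hf i j (fun k => (hp k).lift) hc.lift (DefFun.var (Sum.inr ()))))
    (DefPred.eq
      (DefFun.slice hf i j (fun k => (hp k).lift) hu.lift (DefFun.var (Sum.inr ())))
      (DefFun.slice hf i j (fun k => (hp k).lift) hc.lift (DefFun.var (Sum.inr ()))))

theorem DefPred.isSliceMedian (hf : DefFun L f) (i j : Fin n) {p : (α → B) → Fin n → B}
    {c x y z w : (α → B) → B} (hp : ∀ k, DefFun L fun v => p v k) (hc : DefFun L c)
    (hx : DefFun L x) (hy : DefFun L y) (hz : DefFun L z) (hw : DefFun L w) :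
    DefPred L fun v => IsSliceMedian f i j (p v) (c v) (x v) (y v) (z v) (w v) := by
  have low : ∀ {x y : (α → B) → B}, DefFun L x → DefFun L y → DefPred L fun v =>
      ∀ s, SliceLE f i j (p v) (c v) s (x v) → SliceLE f i j (p v) (c v) s (y v) →
        SliceLE f i j (p v) (c v) s (w v) := fun hx hy =>
    have h := fun {g : (α → B) → B} (hg : DefFun L g) =>
      DefPred.sliceLE hf i j (fun k => (hp k).lift (β := Unit)) hc.lift (DefFun.var (Sum.inr ()))
        hg.lift
    DefPred.all <| (h hx).imp <| (h hy).imp (h hw)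
  have high : ∀ {x y : (α → B) → B}, DefFun L x → DefFun L y → DefPred L fun v =>
      ∀ s, SliceLE f i j (p v) (c v) (x v) s → SliceLE f i j (p v) (c v) (y v) s →
        SliceLE f i j (p v) (c v) (w v) s := fun hx hy =>
    have h := fun {g : (α → B) → B} (hg : DefFun L g) =>
      DefPred.sliceLE hf i j (fun k => (hp k).lift (β := Unit)) hc.lift hg.lift
        (DefFun.var (Sum.inr ()))
    DefPred.all <| (h hx).imp <| (h hy).imp (h hw)
  exact ((low hx hy).and <| (low hy hz).and (low hz hx)).and <|
    (high hx hy).and <| (high hy hz).and (high hz hx)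

end SliceDefinability

/-! ### The median from a non-linear operation -/

section Median

variable {B : Type u} [BooleanAlgebra B]

/-- The median `xy + yz + zx`. -/
def median (x y z : B) : B := (x ⊓ y) ∆ (y ⊓ z) ∆ (z ⊓ x)

theorem Character.map_median (χ : Character B) (x y z : B) :
    χ (median x y z) = ((χ x && χ y) ^^ (χ y && χ z) ^^ (χ z && χ x)) := by
  simp only [median, χ.map_symmDiff, χ.map_inf]

variable {n : ℕ} {f : (Fin n → B) → B} {i j : Fin n} {F : (Fin n → Bool) → Bool}
  {p : Fin n → B} {c : B}

/-- In any Boolean algebra the join of the pairwise meets equals the meet of the pairwise joins, so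
the bounds pin down w. The median commutes with translation by c, hence the result does not depend
on c. -/
theorem IsSliceZero.isSliceMedian_iff
    (hF : ∀ (χ : Character B) v, χ (f v) = F (fun k => χ (v k)))
    (h : IsSliceZero f i j p c) {x y z w : B} :
    IsSliceMedian f i j p c x y z w ↔ median x y z = w := by
  simp only [IsSliceMedian, h.sliceLE_iff hF]
  have hs : ∀ s : B, s ∆ c ∆ c = s := fun s => symmDiff_symmDiff_cancel_right c s
  constructor
  · rintro ⟨⟨h1, h2, h3⟩, h4, h5, h6⟩
    have g1 := h1 (((x ∆ c) ⊓ (y ∆ c)) ∆ c) (by simp [hs]) (by simp [hs])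
    have g2 := h2 (((y ∆ c) ⊓ (z ∆ c)) ∆ c) (by simp [hs]) (by simp [hs])
    have g3 := h3 (((z ∆ c) ⊓ (x ∆ c)) ∆ c) (by simp [hs]) (by simp [hs])
    have g4 := h4 (((x ∆ c) ⊔ (y ∆ c)) ∆ c) (by simp [hs]) (by simp [hs])
    have g5 := h5 (((y ∆ c) ⊔ (z ∆ c)) ∆ c) (by simp [hs]) (by simp [hs])
    have g6 := h6 (((z ∆ c) ⊔ (x ∆ c)) ∆ c) (by simp [hs]) (by simp [hs])
    rw [hs, le_iff_characters] at g1 g2 g3 g4 g5 g6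
    refine eq_of_characters fun χ => ?_
    have g1 := g1 χ
    have g2 := g2 χ
    have g3 := g3 χ
    have g4 := g4 χ
    have g5 := g5 χ
    have g6 := g6 χ
    clear h1 h2 h3 h4 h5 h6 hs
    simp only [χ.map_median, χ.map_symmDiff, χ.map_inf, χ.map_sup] at *
    revert g1 g2 g3 g4 g5 g6
    generalize χ x = a
    generalize χ y = b
    generalize χ z = d
    generalize χ w = e
    generalize χ c = k
    revert a b d e k
    decide
  · rintro rfl
    simp only [le_iff_characters]
    refine ⟨⟨?_, ?_, ?_⟩, ?_, ?_, ?_⟩ <;>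
    · intro s h1 h2 χ
      have h1 := h1 χ
      have h2 := h2 χ
      simp only [χ.map_median, χ.map_symmDiff] at *
      generalize χ x = a at *
      generalize χ y = b at *
      generalize χ z = d at *
      generalize χ s = e at *
      generalize χ c = k at *
      revert a b d e k
      decide

variable {L : FirstOrder.Language} [L.Structure B]

/-- Over a non-linear term operation the median is definable. -/
theorem DefFun.median_of_not_isLinear {t : TermOp B} (ht : ¬ t.IsLinear)
    (h : DefFun L t.toFun) : DefFun L (medianOp B).toFun := by
  obtain ⟨F, hF⟩ := t.isTerm.exists_bool
  obtain ⟨i, j, x, hx⟩ : ∃ i j x, mixedDiff F i j x = true := by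
    -- Distinctness of the two coordinates need not be recorded: for `i = j` the mixed difference
    -- vanishes.
    by_contra hne
    refine ht (TermOp.isLinear_of_mixedDiff hF fun i j x _ => ?_)
    by_contra hx
    exact hne ⟨i, j, x, by simpa using hx⟩
  obtain ⟨p₀, c₀, h₀⟩ := exists_isSliceZero hF hx
  -- All admissible pairs (p, c) give the same median, so they can be quantified existentially and
  -- no parameters remain.
  refine DefFun.of_graph_iff (P := fun w => ∃ (p : Fin t.arity → B) (c : B),
    IsSliceZero t.toFun i j p c ∧
      IsSliceMedian t.toFun i j p c (w (some (0 : Fin 3))) (w (some (1 : Fin 3)))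
        (w (some (2 : Fin 3))) (w none)) ?_ fun w => ?_
  · refine DefPred.ex_tuple <| DefPred.ex <| DefPred.and ?_ ?_
    · exact DefPred.isSliceZero h i j (fun k => DefFun.var (Sum.inl (Sum.inr k))) (DefFun.var (Sum.inr ()))
    · exact DefPred.isSliceMedian h i j (fun k => DefFun.var (Sum.inl (Sum.inr k))) (DefFun.var (Sum.inr ()))
        (DefFun.var (Sum.inl (Sum.inl _))) (DefFun.var (Sum.inl (Sum.inl _))) (DefFun.var (Sum.inl (Sum.inl _)))
        (DefFun.var (Sum.inl (Sum.inl _)))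
  · constructor
    · intro hw
      exact ⟨p₀, c₀, h₀, (h₀.isSliceMedian_iff hF).2 hw⟩
    · rintro ⟨p, c, h1, h2⟩
      exact (h1.isSliceMedian_iff hF).1 h2

end Median

/-! ### Closure rules among the features; what the median defines -/

section Closure

variable {B : Type u} [BooleanAlgebra B] {L : FirstOrder.Language} [L.Structure B] {α : Type*}

theorem DefFun.bot (h : DefFun L (zeroOp B).toFun) : DefFun L fun _ : α → B => ⊥ :=
  DefFun.comp h (F := fun _ => Fin.elim0) fun i => i.elim0

theorem DefFun.top (h : DefFun L (oneOp B).toFun) : DefFun L fun _ : α → B => ⊤ :=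
  DefFun.comp h (F := fun _ => Fin.elim0) fun i => i.elim0

theorem DefFun.compl (h : DefFun L (negOp B).toFun) {f : (α → B) → B} (hf : DefFun L f) :
    DefFun L fun v => (f v)ᶜ :=
  DefFun.comp h (F := fun v _ => f v) fun _ => hf

theorem DefFun.sum (h : DefFun L (sumOp B).toFun) {f g k : (α → B) → B} (hf : DefFun L f)
    (hg : DefFun L g) (hk : DefFun L k) : DefFun L fun v => f v ∆ g v ∆ k v := by
  refine DefFun.comp (β := Fin 3) h (F := fun v => ![f v, g v, k v]) fun i => ?_
  fin_cases i
  exacts [hf, hg, hk]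

theorem DefFun.median (h : DefFun L (medianOp B).toFun) {f g k : (α → B) → B} (hf : DefFun L f)
    (hg : DefFun L g) (hk : DefFun L k) : DefFun L fun v => median (f v) (g v) (k v) := by
  refine DefFun.comp (β := Fin 3) h (F := fun v => ![f v, g v, k v]) fun i => ?_
  fin_cases i
  exacts [hf, hg, hk]

theorem DefFun.one_of_neg_zero (hn : DefFun L (negOp B).toFun) (h0 : DefFun L (zeroOp B).toFun) :
    DefFun L (oneOp B).toFun :=
  (DefFun.compl hn (DefFun.bot h0)).congr fun _ => compl_bot.symm

theorem DefFun.zero_of_neg_one (hn : DefFun L (negOp B).toFun) (h1 : DefFun L (oneOp B).toFun) :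
    DefFun L (zeroOp B).toFun :=
  (DefFun.compl hn (DefFun.top h1)).congr fun _ => compl_top.symm

theorem DefFun.neg_of_sum (hs : DefFun L (sumOp B).toFun) (h0 : DefFun L (zeroOp B).toFun)
    (h1 : DefFun L (oneOp B).toFun) : DefFun L (negOp B).toFun :=
  (DefFun.sum hs (DefFun.var (0 : Fin 1)) (DefFun.bot h0) (DefFun.top h1)).congr fun v => by simp [negOp]

/-- Two elements are complementary exactly when their median with every x is x; testing x = 0 and x
= 1 suffices. -/
theorem DefFun.neg_of_median (hm : DefFun L (medianOp B).toFun) : DefFun L (negOp B).toFun := by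
  refine DefFun.of_graph_iff (α := Fin 1) (P := fun w : Option (Fin 1) → B =>
    ∀ x, BooleanReduct.median (w (some (0 : Fin 1))) (w none) x = x) ?_ fun w => ?_
  · exact DefPred.all <| DefPred.eq
      (DefFun.median hm (DefFun.var (Sum.inl _)) (DefFun.var (Sum.inl _)) (DefFun.var (Sum.inr ())))
      (DefFun.var (Sum.inr ()))
  · change (w (some 0))ᶜ = w none ↔ _
    constructor
    · intro h x
      rw [← h]
      refine eq_of_characters fun χ => ?_
      rw [χ.map_median, χ.map_compl]
      cases χ (w (some 0)) <;> cases χ x <;> rfl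
    · intro h
      refine eq_of_characters fun χ => ?_
      have h0 := congrArg χ (h ⊥)
      have h1 := congrArg χ (h ⊤)
      rw [χ.map_median] at h0 h1
      rw [χ.map_compl]
      rw [χ.map_bot] at h0
      rw [χ.map_top] at h1
      revert h0 h1
      generalize χ (w (some 0)) = a
      generalize χ (w none) = b
      revert a b
      decide

/-- With the median and the two constants all term functions are definable. -/
theorem IsTermFunction.defFun (hm : DefFun L (medianOp B).toFun) (h0 : DefFun L (zeroOp B).toFun)
    (h1 : DefFun L (oneOp B).toFun) {n : ℕ} {f : (Fin n → B) → B} (hf : IsTermFunction f) :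
    DefFun L f := by
  induction hf with
  | proj i => exact DefFun.var i
  | bot => exact DefFun.bot h0
  | top => exact DefFun.top h1
  | compl _ ih => exact DefFun.compl (DefFun.neg_of_median hm) ih
  | inf _ _ ihf ihg =>
    exact (DefFun.median hm ihf ihg (DefFun.bot h0)).congr fun v => by simp [BooleanReduct.median]
  | sup _ _ ihf ihg =>
    refine (DefFun.median hm ihf ihg (DefFun.top h1)).congr fun v => eq_of_characters fun χ => ?_
    rw [χ.map_median, χ.map_sup, χ.map_top]
    generalize χ _ = a
    generalize χ _ = b
    revert a b; decide

/-- Conjugates of term functions by the translation by one of the variables are definable from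
the median. -/
theorem IsTermFunction.defFun_translate (hm : DefFun L (medianOp B).toFun) {n : ℕ}
    {f : (Fin n → B) → B} (hf : IsTermFunction f) (k : Fin n) :
    DefFun L fun v => f (fun i => v i ∆ v k) ∆ v k := by
  have hn := DefFun.neg_of_median hm
  induction hf with
  | proj i => exact (DefFun.var i).congr fun v => symmDiff_symmDiff_cancel_right _ _
  | bot => exact (DefFun.var k).congr fun v => by simp
  | top => exact (DefFun.compl hn (DefFun.var k)).congr fun v => by simp
  | compl _ ih =>
    refine (DefFun.compl hn ih).congr fun v => eq_of_characters fun χ => ?_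
    simp only [χ.map_compl, χ.map_symmDiff]
    generalize χ _ = a
    generalize χ _ = b
    revert a b; decide
  | inf _ _ ihf ihg =>
    -- In the algebra translated by `v k`, the bottom is `v k` and the top its complement; the
    -- median with bottom is the meet, with top the join.
    refine (DefFun.median hm ihf ihg (DefFun.var k)).congr fun v => eq_of_characters fun χ => ?_
    simp only [χ.map_median, χ.map_symmDiff, χ.map_inf]
    generalize χ _ = a
    generalize χ _ = b
    generalize χ _ = c
    revert a b c; decide
  | sup _ _ ihf ihg =>
    refine (DefFun.median hm ihf ihg (DefFun.compl hn (DefFun.var k))).congr fun v =>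
      eq_of_characters fun χ => ?_
    simp only [χ.map_median, χ.map_symmDiff, χ.map_sup, χ.map_compl]
    generalize χ _ = a
    generalize χ _ = b
    generalize χ _ = c
    revert a b c; decide

/-- A term operation is self-dual if it commutes with the complement. -/
def TermOp.IsSelfDual (t : TermOp B) : Prop :=
  ∀ v, t.toFun (fun i => (v i)ᶜ) = (t.toFun v)ᶜ

/-- Self-duality makes the operation equal to its conjugate by translation with one of its own
variables. Such a variable exists, since no constant is self-dual when 0 ≠ 1. -/
theorem TermOp.IsSelfDual.defFun [Nontrivial B] {t : TermOp B} (ht : t.IsSelfDual)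
    (hm : DefFun L (medianOp B).toFun) : DefFun L t.toFun := by
  obtain ⟨F, hF⟩ := t.isTerm.exists_bool
  obtain ⟨χ₀, -⟩ := exists_character (B := B) (b := ⊤) top_ne_bot
  have hdual : ∀ x, F (fun i => !x i) = !F x := by
    intro x
    have h := congrArg χ₀ (ht fun i => ofBool (x i))
    simpa only [hF, χ₀.map_compl, χ₀.map_ofBool] using h
  rcases Nat.eq_zero_or_pos t.arity with h0 | hpos
  · have h := hdual (fun _ => false)
    have e : (fun _ => !false : Fin t.arity → Bool) = fun _ => false :=
      funext fun i => (Fin.cast h0 i).elim0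
    rw [e] at h
    cases hx : F (fun _ => false) <;> simp [hx] at h
  · refine (t.isTerm.defFun_translate hm ⟨0, hpos⟩).congr fun v => eq_of_characters fun χ => ?_
    simp only [hF, χ.map_symmDiff]
    cases χ (v ⟨0, hpos⟩)
    · simp
    · simp [hdual]

theorem DefFun.sum_of_median [Nontrivial B] (hm : DefFun L (medianOp B).toFun) :
    DefFun L (sumOp B).toFun := by
  refine TermOp.IsSelfDual.defFun (t := sumOp B) (fun v => eq_of_characters fun χ => ?_) hm
  simp only [sumOp, χ.map_symmDiff, χ.map_compl]
  generalize χ _ = a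
  generalize χ _ = b
  generalize χ _ = c
  revert a b c; decide

/-- Failure of self-duality gives a Boolean tuple on which the operation agrees with its value at
the complementary tuple. Substituting y or its complement accordingly yields a unary function with
constant value 0 or 1. -/
theorem DefFun.zero_of_not_isSelfDual {t : TermOp B} (ht : ¬ t.IsSelfDual)
    (hm : DefFun L (medianOp B).toFun) (h : DefFun L t.toFun) : DefFun L (zeroOp B).toFun := by
  obtain ⟨F, hF⟩ := t.isTerm.exists_bool
  have hn := DefFun.neg_of_median hm
  obtain ⟨x, hx⟩ : ∃ x, F (fun i => !x i) = F x := by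
    by_contra hne
    push Not at hne
    refine ht fun v => eq_of_characters fun χ => ?_
    rw [χ.map_compl, hF, hF]
    simp only [χ.map_compl]
    exact Bool.eq_not.2 (hne _)
  let g : B → B := fun y => t.toFun fun i => if x i then yᶜ else y
  have hg : ∀ y, g y = ofBool (F x) := by
    intro y
    refine eq_of_characters fun χ => ?_
    rw [χ.map_ofBool, hF]
    cases hy : χ y
    · congr 1
      ext i
      cases hi : x i <;> simp [hy, χ.map_compl]
    · rw [← hx]
      congr 1
      ext i
      cases hi : x i <;> simp [hy, χ.map_compl]
  have hgd : ∀ {β : Type} (b : β), DefFun L fun v : β → B => g (v b) := by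
    intro β b
    refine DefFun.comp h (F := fun v i => if x i then (v b)ᶜ else v b) fun i => ?_
    cases x i
    · exact DefFun.var b
    · exact DefFun.compl hn (DefFun.var b)
  have hc : DefFun L fun _ : Fin 0 → B => (ofBool (F x) : B) := by
    -- As g is constant, the equation g(w) = w defines its value.
    refine DefFun.of_graph_iff
      (DefPred.eq (hgd (none : Option (Fin 0))) (DefFun.var none)) fun w => ?_
    rw [hg]
  cases hFx : F x with
  | false => exact hc.congr fun _ => by rw [hFx]; rfl
  | true => exact DefFun.zero_of_neg_one hn (hc.congr fun _ => by rw [hFx]; rfl)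

end Closure

/-! ### Sums in the Boolean ring -/

section Linear

variable {B : Type u} [BooleanAlgebra B] {L : FirstOrder.Language} [L.Structure B] {α : Type*}

/-- The sum of finitely many elements in the Boolean ring. -/
def finsetSum {ι : Type*} (s : Finset ι) (v : ι → B) : B :=
  ofBoolRing (∑ i ∈ s, toBoolRing (v i))

theorem finsetSum_empty {ι : Type*} (v : ι → B) : finsetSum ∅ v = ⊥ := by
  simp [finsetSum]

theorem finsetSum_insert {ι : Type*} [DecidableEq ι] {s : Finset ι} {i : ι} (hi : i ∉ s)
    (v : ι → B) : finsetSum (insert i s) v = v i ∆ finsetSum s v := by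
  simp [finsetSum, Finset.sum_insert hi]

theorem finsetSum_const {ι : Type*} (s : Finset ι) (v : ι → B) (x : B) (h : ∀ i ∈ s, v i = x) :
    finsetSum s v = if Even s.card then ⊥ else x := by
  classical
  induction s using Finset.induction_on with
  | empty => simp [finsetSum_empty]
  | insert i s hi ih =>
    rw [finsetSum_insert hi, ih fun j hj => h j (Finset.mem_insert_of_mem hj),
      h i (Finset.mem_insert_self i s), Finset.card_insert_of_notMem hi]
    by_cases he : Even s.card <;> simp [he, Nat.even_add_one]

theorem TermOp.isLinear_iff {t : TermOp B} : t.IsLinear ↔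
    ∃ (s : Finset (Fin t.arity)) (c : Bool), ∀ v, t.toFun v = finsetSum s v ∆ ofBool c := by
  constructor
  · rintro ⟨s, c, hc, h⟩
    have h' : ∀ v, t.toFun v = finsetSum s v ∆ ofBoolRing c := fun v => by
      rw [finsetSum, ← ofBoolRing_add, ← h]; rfl
    rcases hc with rfl | rfl
    · exact ⟨s, false, h'⟩
    · exact ⟨s, true, h'⟩
  · rintro ⟨s, c, h⟩
    refine ⟨s, toBoolRing (ofBool c), ?_, fun v => ?_⟩
    · cases c
      · exact Or.inl rfl
      · exact Or.inr rfl
    · rw [h, toBoolRing_symmDiff]; rfl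

/-- Sums with an even number of terms may be added to a definable function. -/
theorem DefFun.add_finsetSum (hs : DefFun L (sumOp B).toFun) {ι : Type*} (k : ℕ) :
    ∀ (s : Finset ι), s.card = 2 * k → ∀ {f : (ι → B) → B}, DefFun L f →
      DefFun L fun v => f v ∆ finsetSum s v := by
  classical
  induction k with
  | zero =>
    intro s h f hf
    have : s = ∅ := Finset.card_eq_zero.1 h
    subst this
    exact hf.congr fun v => by simp [finsetSum_empty]
  | succ k ih =>
    intro s h f hf
    -- Variables are absorbed two at a time, since f + x_i + x_j is one application of the ternary
    -- sum.
    obtain ⟨i, s, hi, rfl, h1⟩ := Finset.card_eq_succ.1 (show s.card = (2 * k + 1) + 1 by omega)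
    obtain ⟨j, s, hj, rfl, h2⟩ := Finset.card_eq_succ.1 h1
    refine (ih s h2 (DefFun.sum hs hf (DefFun.var i) (DefFun.var j))).congr fun v => ?_
    rw [finsetSum_insert hi, finsetSum_insert hj]
    simp only [symmDiff_assoc]

theorem DefFun.const (h0 : DefFun L (zeroOp B).toFun) (h1 : DefFun L (oneOp B).toFun) (c : Bool) :
    DefFun L fun _ : α → B => (ofBool c : B) := by
  cases c
  exacts [DefFun.bot h0, DefFun.top h1]

end Linear

/-! ### Features, and the reduction of every operation to features -/

/-- The five operations generating all functional reducts up to interdefinability. -/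
inductive Feature
  | zero
  | one
  | neg
  | sum
  | median
  deriving DecidableEq

/-- The operation of a feature. -/
def Feature.op (B : Type u) [BooleanAlgebra B] : Feature → TermOp B
  | .zero => zeroOp B
  | .one => oneOp B
  | .neg => negOp B
  | .sum => sumOp B
  | .median => medianOp B

section Features

variable {B : Type u} [BooleanAlgebra B] {L : FirstOrder.Language} [L.Structure B] {t : TermOp B}

/-- The constant feature with a given value. -/
def Feature.const : Bool → Feature
  | false => .zero
  | true => .one

theorem DefFun.const_op_iff (c : Bool) :
    DefFun L (((Feature.const c).op B).toFun) ↔ DefFun L fun _ : Fin 0 → B => (ofBool c : B) := by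
  cases c <;> rfl

/-- The features needed to define `x_{i₁} + ⋯ + x_{iₘ} + c`. -/
def linearFeatures (m : ℕ) (c : Bool) : Set Feature :=
  {f | (Even m ∧ f = Feature.const c) ∨ (2 ≤ m ∧ f = .sum) ∨ (¬ Even m ∧ c = true ∧ f = .neg)}

theorem defFun_iff_linearFeatures {s : Finset (Fin t.arity)} {c : Bool}
    (h : ∀ v, t.toFun v = finsetSum s v ∆ ofBool c) :
    DefFun L t.toFun ↔ ∀ f ∈ linearFeatures s.card c, DefFun L (f.op B).toFun := by
  classical
  constructor
  · rintro ht f (⟨he, rfl⟩ | ⟨h2, rfl⟩ | ⟨ho, rfl, rfl⟩)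
    · rw [DefFun.const_op_iff]
      -- With an even number of equal arguments the sum cancels, leaving the constant c.
      refine DefFun.of_graph_iff (DefPred.eq (DefFun.comp ht
        (F := fun (w : Option (Fin 0) → B) _ => w none) fun _ => DefFun.var none)
        (DefFun.var none)) fun w => ?_
      rw [h, finsetSum_const s _ (w none) fun _ _ => rfl, if_pos he, bot_symmDiff]
    · obtain ⟨i, s', hi, rfl, h1⟩ := Finset.card_eq_succ.1
        (show s.card = (s.card - 2 + 1) + 1 by omega)
      obtain ⟨j, s', hj, rfl, h2⟩ := Finset.card_eq_succ.1 h1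
      have hij : i ≠ j := fun e => hi (by simp [e])
      have his : i ∉ s' := fun e => hi (by simp [e])
      let g : B → B → B → B := fun x y z =>
        t.toFun fun k => if k = i then x else if k = j then y else z
      have hg : ∀ x y z, g x y z =
          x ∆ (y ∆ (if Even s'.card then ⊥ else z)) ∆ ofBool c := by
        intro x y z
        simp only [g]
        rw [h, finsetSum_insert hi, finsetSum_insert hj, finsetSum_const s' _ z]
        · simp [hij.symm]
        · intro k hk
          have h3 : k ≠ i := fun e => his (e ▸ hk)
          have h4 : k ≠ j := fun e => hj (e ▸ hk)
          simp [h3, h4]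
      have hgd : ∀ {a b d : (Fin 3 → B) → B}, DefFun L a → DefFun L b → DefFun L d →
          DefFun L fun v => g (a v) (b v) (d v) := by
        intro a b d ha hb hd
        refine DefFun.comp ht
          (F := fun v k => if k = i then a v else if k = j then b v else d v) fun k => ?_
        by_cases hki : k = i
        · simpa [hki] using ha
        · by_cases hkj : k = j
          · simpa [hki, hkj, hij.symm] using hb
          · simpa [hki, hkj] using hd
      -- Since g(x,y,z) = x+y+εz+c, where ε is the parity of the remaining variables, both εz and c
      -- cancel in g(g(x,y,z),z,z) = x+y+z.
      refine (hgd (hgd (DefFun.var 0) (DefFun.var 1) (DefFun.var 2))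
        (DefFun.var 2) (DefFun.var 2)).congr fun v => eq_of_characters fun χ => ?_
      change χ (v (0 : Fin 3) ∆ v (1 : Fin 3) ∆ v (2 : Fin 3)) = _
      simp only [hg]
      split_ifs <;>
      · simp only [χ.map_symmDiff, χ.map_ofBool, χ.map_bot]
        generalize χ (v 0) = a
        generalize χ (v 1) = b
        generalize χ (v 2) = d
        clear hgd hg h
        revert a b c d
        decide
    · refine (DefFun.comp ht (F := fun (w : Fin 1 → B) _ => w 0) fun _ => DefFun.var 0).congr
        fun w => ?_
      rw [h, finsetSum_const s _ (w 0) fun _ _ => rfl, if_neg ho]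
      simp [Feature.op, negOp, ofBool]
  · intro hf
    by_cases he : Even s.card
    · have hc : DefFun L fun _ : Fin t.arity → B => (ofBool c : B) :=
        (((DefFun.const_op_iff c).1 (hf _ (Or.inl ⟨he, rfl⟩))).reindex Fin.elim0)
      rcases Nat.eq_zero_or_pos s.card with h0 | hpos
      · have : s = ∅ := Finset.card_eq_zero.1 h0
        subst this
        exact hc.congr fun v => by rw [h, finsetSum_empty, bot_symmDiff]
      · obtain ⟨k, hk⟩ := he
        have hs := hf .sum (Or.inr (Or.inl ⟨by omega, rfl⟩))
        exact (DefFun.add_finsetSum hs k s (by omega) hc).congr fun v => by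
          rw [h, symmDiff_comm]
    · have hodd : DefFun L fun v : Fin t.arity → B => finsetSum s v := by
        obtain ⟨k, hk⟩ := Nat.not_even_iff_odd.1 he
        obtain ⟨i, s', hi, rfl, h1⟩ := Finset.card_eq_succ.1 hk
        rcases Nat.eq_zero_or_pos k with h0 | hpos
        · have : s' = ∅ := Finset.card_eq_zero.1 (by omega)
          subst this
          exact (DefFun.var i).congr fun v => by
            rw [finsetSum_insert hi, finsetSum_empty, symmDiff_bot]
        · have hs := hf .sum (Or.inr (Or.inl ⟨by omega, rfl⟩))
          exact (DefFun.add_finsetSum hs k s' h1 (DefFun.var i)).congr fun v =>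
            finsetSum_insert hi v
      cases c with
      | false => exact hodd.congr fun v => by rw [h]; simp [ofBool]
      | true =>
        exact (DefFun.compl (hf .neg (Or.inr (Or.inr ⟨he, rfl, rfl⟩))) hodd).congr fun v => by
          rw [h]; simp [ofBool]

/-- Definability of a term operation amounts to definability of some of the features. -/
theorem TermOp.exists_features [Nontrivial B] (t : TermOp B) :
    ∃ F : Set Feature, ∀ R : FunctionalReduct B,
      DefFun R.language t.toFun ↔ ∀ f ∈ F, DefFun R.language (f.op B).toFun := by
  by_cases hl : t.IsLinear
  · obtain ⟨s, c, h⟩ := TermOp.isLinear_iff.1 hl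
    exact ⟨linearFeatures s.card c, fun R => defFun_iff_linearFeatures h⟩
  · by_cases hd : t.IsSelfDual
    · refine ⟨{.median}, fun R => ⟨?_, fun h => hd.defFun (h .median rfl)⟩⟩
      rintro h f rfl
      exact DefFun.median_of_not_isLinear hl h
    · refine ⟨{.median, .zero}, fun R => ⟨?_, fun h => ?_⟩⟩
      · rintro h f (rfl | rfl)
        · exact DefFun.median_of_not_isLinear hl h
        · exact DefFun.zero_of_not_isSelfDual hd (DefFun.median_of_not_isLinear hl h) h
      · have hm := h .median (Or.inl rfl)
        have h0 := h .zero (Or.inr rfl)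
        exact t.isTerm.defFun hm h0 (DefFun.one_of_neg_zero (DefFun.neg_of_median hm) h0)

end Features

/-! ### The finite combinatorics of the thirteen nodes -/

instance : Fintype Node :=
  ⟨{.ba, .median, .addZeroOne, .negZeroOne, .zeroOne, .add, .addOne, .sumOne, .zero, .one, .sum,
    .neg, .id}, fun i => by cases i <;> decide⟩

instance : Fintype Feature :=
  ⟨{.zero, .one, .neg, .sum, .median}, fun f => by cases f <;> decide⟩

/-- The features definable in the reduct of a node. -/
def Node.features : Node → Feature → Bool
  | .ba, _ => true
  | .median, f => f = .neg ∨ f = .sum ∨ f = .median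
  | .addZeroOne, f => f ≠ .median
  | .negZeroOne, f => f = .zero ∨ f = .one ∨ f = .neg
  | .zeroOne, f => f = .zero ∨ f = .one
  | .add, f => f = .zero ∨ f = .sum
  | .addOne, f => f = .one ∨ f = .sum
  | .sumOne, f => f = .neg ∨ f = .sum
  | .zero, f => f = .zero
  | .one, f => f = .one
  | .sum, f => f = .sum
  | .neg, f => f = .neg
  | .id, _ => false

/-- The order of the lattice, as reverse inclusion of sets of features. -/
def Node.Le (i j : Node) : Prop := ∀ f, j.features f = true → i.features f = true

instance : DecidableRel Node.Le := fun i j =>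
  inferInstanceAs (Decidable (∀ f, j.features f = true → i.features f = true))

section Order

/-- Boolean form of the edge relation. -/
def Node.edge : Node → Node → Bool
  | .ba, j => j = .median ∨ j = .addZeroOne
  | .median, j => j = .sumOne
  | .addZeroOne, j => j = .negZeroOne ∨ j = .add ∨ j = .addOne ∨ j = .sumOne
  | .negZeroOne, j => j = .zeroOne ∨ j = .neg
  | .zeroOne, j => j = .zero ∨ j = .one
  | .add, j => j = .zero ∨ j = .sum
  | .addOne, j => j = .one ∨ j = .sum
  | .sumOne, j => j = .sum ∨ j = .neg
  | .id, _ => false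
  | _, j => j = .id

theorem Node.Edge.of_edge {i j : Node} (h : i.edge j = true) : Node.Edge i j := by
  cases i <;> cases j <;> first | constructor | exact absurd h (by decide)

theorem Node.Edge.le {i j : Node} (h : Node.Edge i j) : i.Le j := by
  cases h <;> decide

/-- The number of features of a node. -/
def Node.rank (i : Node) : ℕ := (Finset.univ.filter fun f => i.features f = true).card

/-- This is the descent step turning inclusion of feature sets into a path in the diagram: an edge
towards `j` that strictly loses features. -/
theorem Node.Le.eq_or_exists_edge : ∀ i j : Node, i.Le j →
    i = j ∨ ∃ k : Node, i.edge k = true ∧ k.Le j ∧ k.rank < i.rank := by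
  decide

theorem Node.Le.below {i j : Node} (h : i.Le j) : i.Below j := by
  induction hn : i.rank using Nat.strong_induction_on generalizing i with
  | _ n ih =>
    rcases Node.Le.eq_or_exists_edge i j h with rfl | ⟨k, hk, hkj, hr⟩
    · exact Relation.ReflTransGen.refl
    · exact Relation.ReflTransGen.head (.of_edge hk) (ih _ (hn ▸ hr) hkj rfl)

theorem Node.below_iff_le {i j : Node} : i.Below j ↔ i.Le j := by
  refine ⟨fun h => ?_, Node.Le.below⟩
  induction h with
  | refl => exact fun _ hf => hf
  | tail _ h ih => exact fun f hf => ih f (h.le f hf)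

theorem Node.Le.antisymm : ∀ {i j : Node}, i.Le j → j.Le i → i = j := by
  decide

theorem Node.exists_sup : ∀ i j : Node, ∃ k : Node, i.Le k ∧ j.Le k ∧
    ∀ l : Node, i.Le l → j.Le l → k.Le l := by
  decide

end Order

/-! ### Which features each node's reduct defines -/

section Nodes

variable {B : Type u} [BooleanAlgebra B]

open FunctionalReduct

theorem defines_cons {R : FunctionalReduct B} {t : TermOp B} {l : List (TermOp B)} :
    R.Defines ⟨t :: l⟩ ↔ DefFun R.language t.toFun ∧ R.Defines ⟨l⟩ := by
  simp only [FunctionalReduct.Defines, List.forall_mem_cons]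
  rfl

theorem defines_nil {R : FunctionalReduct B} : R.Defines ⟨[]⟩ ↔ True := by
  simp [FunctionalReduct.Defines]

variable {L : FirstOrder.Language} [L.Structure B]

theorem defFun_addOp_iff : DefFun L (addOp B).toFun ↔
    DefFun L (zeroOp B).toFun ∧ DefFun L (sumOp B).toFun := by
  have key : DefFun L (addOp B).toFun ↔ ∀ f ∈ linearFeatures 2 false, DefFun L (f.op B).toFun :=
    defFun_iff_linearFeatures (t := addOp B) (s := ({0, 1} : Finset (Fin 2))) (c := false)
      fun v => by simp [addOp, finsetSum, ofBool]
  rw [key]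
  constructor
  · intro h
    exact ⟨h .zero (Or.inl ⟨by decide, rfl⟩), h .sum (Or.inr (Or.inl ⟨by decide, rfl⟩))⟩
  · rintro ⟨h0, hs⟩ f (⟨-, rfl⟩ | ⟨-, rfl⟩ | ⟨h, -⟩)
    exacts [h0, hs, absurd (by decide) h]

theorem defFun_addOneOp_iff : DefFun L (addOneOp B).toFun ↔
    DefFun L (oneOp B).toFun ∧ DefFun L (sumOp B).toFun := by
  have key : DefFun L (addOneOp B).toFun ↔ ∀ f ∈ linearFeatures 2 true, DefFun L (f.op B).toFun :=
    defFun_iff_linearFeatures (t := addOneOp B) (s := ({0, 1} : Finset (Fin 2))) (c := true)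
      fun v => by simp [addOneOp, finsetSum, ofBool]
  rw [key]
  constructor
  · intro h
    exact ⟨h .one (Or.inl ⟨by decide, rfl⟩), h .sum (Or.inr (Or.inl ⟨by decide, rfl⟩))⟩
  · rintro ⟨h0, hs⟩ f (⟨-, rfl⟩ | ⟨-, rfl⟩ | ⟨h, -⟩)
    exacts [h0, hs, absurd (by decide) h]

theorem defFun_sumOneOp_iff : DefFun L (sumOneOp B).toFun ↔
    DefFun L (negOp B).toFun ∧ DefFun L (sumOp B).toFun := by
  have key : DefFun L (sumOneOp B).toFun ↔ ∀ f ∈ linearFeatures 3 true, DefFun L (f.op B).toFun :=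
    defFun_iff_linearFeatures (t := sumOneOp B) (s := ({0, 1, 2} : Finset (Fin 3))) (c := true)
      fun v => by simp [sumOneOp, finsetSum, ofBool, symmDiff_assoc]
  rw [key]
  constructor
  · intro h
    exact ⟨h .neg (Or.inr (Or.inr ⟨by decide, rfl, rfl⟩)),
      h .sum (Or.inr (Or.inl ⟨by decide, rfl⟩))⟩
  · rintro ⟨h0, hs⟩ f (⟨h, -⟩ | ⟨-, rfl⟩ | ⟨-, -, rfl⟩)
    exacts [absurd h (by decide), hs, h0]

theorem DefFun.median_of_inf_sup (hi : DefFun L (infOp B).toFun) (hs : DefFun L (supOp B).toFun) :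
    DefFun L (medianOp B).toFun := by
  have hinf : ∀ {f g : (Fin 3 → B) → B}, DefFun L f → DefFun L g → DefFun L fun v => f v ⊓ g v := by
    intro f g hf hg
    refine DefFun.comp (β := Fin 2) hi (F := fun v => ![f v, g v]) fun i => ?_
    fin_cases i
    exacts [hf, hg]
  have hsup : ∀ {f g : (Fin 3 → B) → B}, DefFun L f → DefFun L g → DefFun L fun v => f v ⊔ g v := by
    intro f g hf hg
    refine DefFun.comp (β := Fin 2) hs (F := fun v => ![f v, g v]) fun i => ?_
    fin_cases i
    exacts [hf, hg]
  refine (hsup (hsup (hinf (DefFun.var 0) (DefFun.var 1)) (hinf (DefFun.var 1) (DefFun.var 2)))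
    (hinf (DefFun.var 2) (DefFun.var 0))).congr fun v => eq_of_characters fun χ => ?_
  simp only [medianOp, χ.map_symmDiff, χ.map_inf, χ.map_sup]
  generalize χ _ = a
  generalize χ _ = b
  generalize χ _ = c
  revert a b c; decide

/-- A reduct defines the reduct of a node iff it defines all features of the node. -/
theorem defines_node_iff [Nontrivial B] {R : FunctionalReduct B} {i : Node} :
    R.Defines (i.reduct B) ↔ ∀ f, i.features f = true → DefFun R.language (f.op B).toFun := by
  have hall : ∀ P : Feature → Prop, (∀ f, P f) ↔
      P .zero ∧ P .one ∧ P .neg ∧ P .sum ∧ P .median := fun P =>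
    ⟨fun h => ⟨h _, h _, h _, h _, h _⟩, fun ⟨h0, h1, h2, h3, h4⟩ f => by cases f <;> assumption⟩
  have hid : DefFun R.language (idOp B).toFun := DefFun.var (0 : Fin 1)
  cases i <;>
    simp [Node.reduct, Node.features, hall, Feature.op, defines_cons, defines_nil,
      defFun_addOp_iff, defFun_addOneOp_iff, defFun_sumOneOp_iff, hid]
  · constructor
    · rintro ⟨hi, hs, h0, h1, hn⟩
      have hm := DefFun.median_of_inf_sup hi hs
      exact ⟨h0, h1, hn, DefFun.sum_of_median hm, hm⟩
    · rintro ⟨h0, h1, hn, -, hm⟩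
      exact ⟨(infOp B).isTerm.defFun hm h0 h1, (supOp B).isTerm.defFun hm h0 h1, h0, h1, hn⟩
  · exact ⟨fun hm => ⟨DefFun.neg_of_median hm, DefFun.sum_of_median hm, hm⟩, fun h => h.2.2⟩
  · constructor
    · rintro ⟨⟨h0, hs⟩, -, h1⟩
      exact ⟨h0, h1, DefFun.neg_of_sum hs h0 h1, hs⟩
    · rintro ⟨h0, h1, -, hs⟩
      exact ⟨⟨h0, hs⟩, h0, h1⟩
  · tauto

theorem Node.Le.defines [Nontrivial B] {i j : Node} (h : i.Le j) :
    (i.reduct B).Defines (j.reduct B) :=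
  defines_node_iff.2 fun f hf => defines_node_iff.1 (Defines.refl _) f (h f hf)

end Nodes

/-! ### Permutations used for separation -/

section Transvection

variable {B : Type u} [BooleanAlgebra B]

/-- The involution adding `a` to all elements `x` with `l x = true`. -/
def transvection (a : B) (l : B → Bool) (h : ∀ x, l (x ∆ a) = l x) : Equiv.Perm B :=
  Function.Involutive.toPerm (fun x => x ∆ (ofBool (l x) ⊓ a)) fun x => by
    cases hx : l x
    · simp [ofBool, hx]
    · simp [ofBool, hx, h]

theorem transvection_apply {a : B} {l : B → Bool} {h : ∀ x, l (x ∆ a) = l x} (x : B) :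
    transvection a l h x = x ∆ (ofBool (l x) ⊓ a) := rfl

/-- The complement as a permutation. -/
def complPerm (B : Type u) [BooleanAlgebra B] : Equiv.Perm B :=
  Function.Involutive.toPerm compl compl_involutive

theorem complPerm_apply (x : B) : complPerm B x = xᶜ := rfl

end Transvection

/-! ### Separating the thirteen groups -/

section Separation

variable {B : Type u} [BooleanAlgebra B]

theorem mem_aut_cons {φ : Equiv.Perm B} {t : TermOp B} {l : List (TermOp B)} :
    φ ∈ (⟨t :: l⟩ : FunctionalReduct B).aut ↔
      (∀ v, φ (t.toFun v) = t.toFun fun i => φ (v i)) ∧ φ ∈ (⟨l⟩ : FunctionalReduct B).aut :=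
  List.forall_mem_cons

theorem mem_aut_nil {φ : Equiv.Perm B} : φ ∈ (⟨[]⟩ : FunctionalReduct B).aut :=
  fun _ h => absurd h List.not_mem_nil

theorem mem_aut_singleton {φ : Equiv.Perm B} {t : TermOp B} :
    φ ∈ (⟨[t]⟩ : FunctionalReduct B).aut ↔ ∀ v, φ (t.toFun v) = t.toFun fun i => φ (v i) :=
  mem_aut_cons.trans (and_iff_left mem_aut_nil)

theorem exists_chain [Nontrivial B] (atomless : ∀ a : B, ¬ IsAtom a) :
    ∃ a b : B, b ≠ ⊥ ∧ b < a ∧ a < ⊤ := by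
  have key : ∀ a : B, a ≠ ⊥ → ∃ b, b ≠ ⊥ ∧ b < a := by
    intro a ha
    by_contra hne
    push Not at hne
    refine atomless a ⟨ha, fun b hb => ?_⟩
    by_contra hb0
    exact hne b hb0 hb
  obtain ⟨a, ha, hlt⟩ := key ⊤ top_ne_bot
  obtain ⟨b, hb, hba⟩ := key a ha
  exact ⟨a, b, hb, hba, hlt⟩

/-- The pairs of a maximal node not having a feature and that feature. -/
def Node.avoids : Node → Feature → Bool
  | .median, f => f = .zero ∨ f = .one
  | .addOne, f => f = .zero ∨ f = .neg
  | .add, f => f = .one ∨ f = .neg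
  | .zeroOne, f => f = .neg
  | .negZeroOne, f => f = .sum
  | .addZeroOne, f => f = .median
  | _, _ => false

/-- Shrinking the group to that of `w` only makes it harder to violate `f`, so separation is needed
for the avoiding pairs alone. -/
theorem Node.exists_avoids_le : ∀ (i : Node) (f : Feature), i.features f = false →
    ∃ w : Node, w.avoids f = true ∧ w.Le i := by
  decide

theorem median_separation [Nontrivial B] : ∃ φ ∈ (Node.median.reduct B).aut,
    φ ∉ (⟨[zeroOp B]⟩ : FunctionalReduct B).aut ∧ φ ∉ (⟨[oneOp B]⟩ : FunctionalReduct B).aut := by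
  refine ⟨complPerm B, ?_, fun h => ?_, fun h => ?_⟩
  · refine mem_aut_singleton.2 fun v => eq_of_characters fun χ => ?_
    simp only [complPerm_apply, medianOp, χ.map_symmDiff, χ.map_inf, χ.map_compl]
    generalize χ _ = a
    generalize χ _ = b
    generalize χ _ = c
    revert a b c; decide
  · have := mem_aut_singleton.1 h Fin.elim0
    simp [complPerm_apply, zeroOp] at this
  · have := mem_aut_singleton.1 h Fin.elim0
    simp [complPerm_apply, oneOp] at this

/-- The transvection x + χ₀(x)a is additive and fixes 0, but sends 1 to 1+a. -/
theorem add_separation {a : B} {χ₀ : Character B} (ha : a ≠ ⊥) (hχ : χ₀ a = false) :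
    ∃ φ ∈ (Node.add.reduct B).aut,
      φ ∉ (⟨[oneOp B]⟩ : FunctionalReduct B).aut ∧ φ ∉ (⟨[negOp B]⟩ : FunctionalReduct B).aut := by
  refine ⟨transvection a χ₀ fun x => by simp [χ₀.map_symmDiff, hχ], ?_, fun h => ?_, fun h => ?_⟩
  · refine mem_aut_singleton.2 fun v => eq_of_characters fun χ => ?_
    simp only [transvection_apply, addOp, χ.map_symmDiff, χ.map_inf, χ.map_ofBool,
      χ₀.map_symmDiff]
    generalize χ _ = a
    generalize χ _ = b
    generalize χ _ = c
    generalize χ₀ _ = d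
    generalize χ₀ _ = e
    revert a b c d e; decide
  · have := mem_aut_singleton.1 h Fin.elim0
    simp [transvection_apply, oneOp, ofBool, χ₀.map_top] at this
    exact ha this
  · have := mem_aut_singleton.1 h fun _ => ⊥
    simp [transvection_apply, negOp, ofBool, χ₀.map_top, χ₀.map_bot] at this
    exact ha this

/-- Dually, x + (1+χ₀(x))a fixes 1 and sends 0 to a. -/
theorem addOne_separation [Nontrivial B] {a : B} {χ₀ : Character B} (ha : a ≠ ⊥) (hχ : χ₀ a = false) :
    ∃ φ ∈ (Node.addOne.reduct B).aut,
      φ ∉ (⟨[zeroOp B]⟩ : FunctionalReduct B).aut ∧ φ ∉ (⟨[negOp B]⟩ : FunctionalReduct B).aut := by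
  refine ⟨transvection a (fun x => !χ₀ x) fun x => by simp [χ₀.map_symmDiff, hχ], ?_,
    fun h => ?_, fun h => ?_⟩
  · refine mem_aut_singleton.2 fun v => eq_of_characters fun χ => ?_
    simp only [transvection_apply, addOneOp, χ.map_symmDiff, χ.map_inf, χ.map_ofBool,
      χ₀.map_symmDiff, χ.map_top, χ₀.map_top]
    generalize χ _ = a
    generalize χ _ = b
    generalize χ _ = c
    generalize χ₀ _ = d
    generalize χ₀ _ = e
    revert a b c d e; decide
  · have := mem_aut_singleton.1 h Fin.elim0
    simp [transvection_apply, zeroOp, ofBool, χ₀.map_bot] at this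
    exact ha this
  · have := mem_aut_singleton.1 h fun _ => ⊥
    simp [transvection_apply, negOp, ofBool, χ₀.map_top, χ₀.map_bot] at this
    exact ha (compl_eq_top.1 this.symm)

/-- The transposition of a and b moves a but fixes its complement, which differs from b because 0 <
b < a. -/
theorem zeroOne_separation [Nontrivial B] {a b : B} (hb : b ≠ ⊥) (hba : b < a) (ha : a < ⊤) :
    ∃ φ ∈ (Node.zeroOne.reduct B).aut, φ ∉ (⟨[negOp B]⟩ : FunctionalReduct B).aut := by
  classical
  have ha0 : a ≠ ⊥ := (bot_le.trans_lt hba).ne'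
  have hbt : b ≠ ⊤ := (hba.trans ha).ne
  refine ⟨Equiv.swap a b, ?_, fun h => ?_⟩
  · refine mem_aut_cons.2 ⟨fun v => ?_, mem_aut_singleton.2 fun v => ?_⟩
    · exact Equiv.swap_apply_of_ne_of_ne ha0.symm hb.symm
    · exact Equiv.swap_apply_of_ne_of_ne ha.ne' hbt.symm
  · have h1 : Equiv.swap a b aᶜ = (Equiv.swap a b a)ᶜ := mem_aut_singleton.1 h fun _ => a
    have h2 : aᶜ ≠ b := by
      rintro rfl
      exact hb (by rw [← inf_eq_left.2 hba.le, compl_inf_self])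
    rw [Equiv.swap_apply_left, Equiv.swap_apply_of_ne_of_ne compl_ne_self h2] at h1
    exact hba.ne' (compl_injective h1)

/-- Exchanging a with its complement respects complements, but it fixes b, 0 and a+b while moving a,
so it cannot preserve a+b+0. -/
theorem negZeroOne_separation [Nontrivial B] {a b : B} (hb : b ≠ ⊥) (hba : b < a) (ha : a < ⊤) :
    ∃ φ ∈ (Node.negZeroOne.reduct B).aut, φ ∉ (⟨[sumOp B]⟩ : FunctionalReduct B).aut := by
  classical
  have ha0 : a ≠ ⊥ := (bot_le.trans_lt hba).ne'
  have hbt : b ≠ ⊤ := (hba.trans ha).ne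
  have hac : aᶜ ≠ ⊥ := fun h => ha.ne (compl_eq_bot.1 h)
  have hac' : aᶜ ≠ ⊤ := fun h => ha0 (compl_eq_top.1 h)
  have h2 : b ≠ aᶜ := by
    rintro rfl
    exact hb (by rw [← inf_eq_left.2 hba.le, compl_inf_self])
  have hbot : Equiv.swap a aᶜ ⊥ = ⊥ := Equiv.swap_apply_of_ne_of_ne ha0.symm hac.symm
  have htop : Equiv.swap a aᶜ ⊤ = ⊤ := Equiv.swap_apply_of_ne_of_ne ha.ne' hac'.symm
  refine ⟨Equiv.swap a aᶜ, ?_, fun h => ?_⟩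
  · refine mem_aut_cons.2 ⟨fun v => ?_, mem_aut_cons.2 ⟨fun v => hbot,
      mem_aut_singleton.2 fun v => htop⟩⟩
    change Equiv.swap a aᶜ (v (0 : Fin 1))ᶜ = (Equiv.swap a aᶜ (v (0 : Fin 1)))ᶜ
    generalize v (0 : Fin 1) = x
    by_cases hx : x = a
    · subst hx; simp
    · by_cases hx' : x = aᶜ
      · subst hx'; simp
      · rw [Equiv.swap_apply_of_ne_of_ne hx hx', Equiv.swap_apply_of_ne_of_ne]
        · exact fun e => hx' (by rw [← e, compl_compl])
        · exact fun e => hx (compl_injective e)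
  · have h1 : Equiv.swap a aᶜ (a ∆ b ∆ ⊥) =
        Equiv.swap a aᶜ a ∆ Equiv.swap a aᶜ b ∆ Equiv.swap a aᶜ ⊥ :=
      mem_aut_singleton.1 h ![a, b, ⊥]
    rw [hbot, Equiv.swap_apply_left, Equiv.swap_apply_of_ne_of_ne hba.ne h2, symmDiff_bot,
      symmDiff_bot, Equiv.swap_apply_of_ne_of_ne] at h1
    · exact compl_ne_self (symmDiff_left_injective b h1).symm
    · simpa using hb
    · intro e
      have : a ∆ b = a ∆ ⊤ := by rw [e, symmDiff_top, hnot_eq_compl]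
      exact hbt (symmDiff_right_injective a this)

/-- The functional χ₁+χ₂ is additive and kills 1 and b, so the transvection along b is additive and
fixes 0 and 1. As χ₁+χ₂ is 1 on a∧¬b, the triple a∧¬b, b, 0 with median 0 goes to a, b, 0 with
median b. -/
theorem addZeroOne_separation {a b : B} (hb : b ≠ ⊥) (hba : b < a) (ha : a < ⊤) :
    ∃ φ ∈ (Node.addZeroOne.reduct B).aut, φ ∉ (⟨[medianOp B]⟩ : FunctionalReduct B).aut := by
  obtain ⟨χ₁, h₁⟩ := exists_character (b := a ⊓ bᶜ) fun h =>
    hba.not_ge (by simpa [disjoint_compl_right_iff] using disjoint_iff.2 h)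
  obtain ⟨χ₂, h₂⟩ := exists_character (b := aᶜ) fun h => ha.ne (compl_eq_bot.1 h)
  have h₁a : χ₁ a = true := by
    rw [χ₁.map_inf] at h₁
    exact (Bool.and_eq_true_iff.1 h₁).1
  have h₁b : χ₁ b = false := by
    rw [χ₁.map_inf, χ₁.map_compl] at h₁
    simpa using (Bool.and_eq_true_iff.1 h₁).2
  have h₂a : χ₂ a = false := by simpa [χ₂.map_compl] using h₂
  have h₂b : χ₂ b = false := by
    by_contra h
    rw [le_iff_characters.1 hba.le χ₂ (by simpa using h)] at h₂a
    cases h₂a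
  refine ⟨transvection b (fun x => χ₁ x ^^ χ₂ x) fun x => by
    simp [χ₁.map_symmDiff, χ₂.map_symmDiff, h₁b, h₂b], ?_, fun h => ?_⟩
  · refine mem_aut_cons.2 ⟨fun v => eq_of_characters fun χ => ?_,
      mem_aut_cons.2 ⟨fun v => ?_, mem_aut_singleton.2 fun v => ?_⟩⟩
    · simp only [transvection_apply, addOp, χ.map_symmDiff, χ.map_inf, χ.map_ofBool,
        χ₁.map_symmDiff, χ₂.map_symmDiff]
      generalize χ _ = a
      generalize χ _ = b
      generalize χ _ = c
      generalize χ₁ _ = d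
      generalize χ₁ _ = e
      generalize χ₂ _ = f
      generalize χ₂ _ = g
      revert a b c d e f g; decide
    · simp [transvection_apply, zeroOp, ofBool, χ₁.map_bot, χ₂.map_bot]
    · simp [transvection_apply, oneOp, ofBool, χ₁.map_top, χ₂.map_top]
  · have h3 := mem_aut_singleton.1 h ![a ⊓ bᶜ, b, ⊥]
    simp [transvection_apply, medianOp, ofBool, χ₁.map_bot, χ₂.map_bot, χ₁.map_inf, χ₂.map_inf,
      χ₁.map_compl, χ₂.map_compl, h₁a, h₁b, h₂a, h₂b] at h3
    obtain ⟨χ, hχ⟩ := exists_character hb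
    have h4 := congrArg χ h3
    simp [χ.map_symmDiff, χ.map_inf, χ.map_compl, hχ] at h4

theorem FunctionalReduct.aut_append (R S : FunctionalReduct B) :
    (⟨R.ops ++ S.ops⟩ : FunctionalReduct B).aut = R.aut ⊓ S.aut := by
  ext φ
  exact List.forall_mem_append

theorem FunctionalReduct.aut_eq_of_defines_iff {R S : FunctionalReduct B}
    (h : ∀ T : FunctionalReduct B, T.Defines R ↔ T.Defines S) : R.aut = S.aut :=
  Interdefinable.aut_eq ⟨(h R).1 (FunctionalReduct.Defines.refl R), (h S).2 (FunctionalReduct.Defines.refl S)⟩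

variable [Nontrivial B]

theorem exists_aut_of_features_eq_false (atomless : ∀ a : B, ¬ IsAtom a) {i : Node} {f : Feature}
    (h : i.features f = false) :
    ∃ φ ∈ (i.reduct B).aut, φ ∉ (⟨[f.op B]⟩ : FunctionalReduct B).aut := by
  obtain ⟨w, hw, hwi⟩ := Node.exists_avoids_le i f h
  suffices ∃ φ ∈ (w.reduct B).aut, φ ∉ (⟨[f.op B]⟩ : FunctionalReduct B).aut by
    obtain ⟨φ, hφ, hφ'⟩ := this
    exact ⟨φ, (Node.Le.defines hwi).aut_le hφ, hφ'⟩
  obtain ⟨a, b, hb, hba, ha⟩ := exists_chain atomless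
  obtain ⟨χ, hχ⟩ := exists_character (b := aᶜ) fun h => ha.ne (compl_eq_bot.1 h)
  have ha0 : a ≠ ⊥ := (bot_le.trans_lt hba).ne'
  have hχa : χ a = false := by simpa [χ.map_compl] using hχ
  obtain ⟨φ₁, k₁, k₁', k₁''⟩ := median_separation (B := B)
  obtain ⟨φ₂, k₂, k₂', k₂''⟩ := add_separation ha0 hχa
  obtain ⟨φ₃, k₃, k₃', k₃''⟩ := addOne_separation ha0 hχa
  cases w <;> cases f <;> first
    | exact absurd hw (by decide)
    | exact ⟨φ₁, k₁, k₁'⟩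
    | exact ⟨φ₁, k₁, k₁''⟩
    | exact ⟨φ₂, k₂, k₂'⟩
    | exact ⟨φ₂, k₂, k₂''⟩
    | exact ⟨φ₃, k₃, k₃'⟩
    | exact ⟨φ₃, k₃, k₃''⟩
    | exact zeroOne_separation hb hba ha
    | exact negZeroOne_separation hb hba ha
    | exact addZeroOne_separation hb hba ha

theorem Node.aut_le_iff (atomless : ∀ a : B, ¬ IsAtom a) {i j : Node} :
    (i.reduct B).aut ≤ (j.reduct B).aut ↔ i.Le j := by
  refine ⟨fun h f hf => ?_, fun h => (Node.Le.defines h).aut_le⟩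
  by_contra hif
  obtain ⟨φ, hφ, hφ'⟩ := exists_aut_of_features_eq_false atomless (Bool.eq_false_iff.2 hif)
  have hd : (j.reduct B).Defines ⟨[f.op B]⟩ := defines_cons.2
    ⟨defines_node_iff.1 (FunctionalReduct.Defines.refl _) f hf, defines_nil.2 trivial⟩
  exact hφ' (hd.aut_le (h hφ))

theorem Node.aut_injective (atomless : ∀ a : B, ¬ IsAtom a) :
    Function.Injective fun i : Node => (i.reduct B).aut := fun _ _ h =>
  Node.Le.antisymm ((Node.aut_le_iff atomless).1 h.le) ((Node.aut_le_iff atomless).1 h.ge)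

end Separation

/-! ### Classification of reducts and the lattice -/

section Classification

variable {B : Type u} [BooleanAlgebra B] [Nontrivial B]

/-- Every set of features generates the features of a node. -/
theorem exists_node_of_features (F : Set Feature) : ∃ i : Node, ∀ R : FunctionalReduct B,
    R.Defines (i.reduct B) ↔ ∀ f ∈ F, DefFun R.language (f.op B).toFun := by
  classical
  have hall : ∀ P : Feature → Prop, (∀ f, P f) ↔
      P .zero ∧ P .one ∧ P .neg ∧ P .sum ∧ P .median := fun P =>
    ⟨fun h => ⟨h _, h _, h _, h _, h _⟩, fun ⟨h0, h1, h2, h3, h4⟩ f => by cases f <;> assumption⟩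
  -- Only the closure rules of definability matter, so it is replaced by an arbitrary predicate
  -- obeying them; what remains is propositional.
  suffices ∃ i : Node, ∀ p : Feature → Prop, (p .neg → p .zero → p .one) →
      (p .neg → p .one → p .zero) → (p .sum → p .zero → p .one → p .neg) →
      (p .median → p .neg) → (p .median → p .sum) →
      ((∀ f, i.features f = true → p f) ↔ ∀ f ∈ F, p f) by
    obtain ⟨i, hi⟩ := this
    exact ⟨i, fun R => defines_node_iff.trans (hi (fun f => DefFun R.language (f.op B).toFun)
      DefFun.one_of_neg_zero DefFun.zero_of_neg_one DefFun.neg_of_sum DefFun.neg_of_median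
      DefFun.sum_of_median)⟩
  let i : Node :=
    if Feature.median ∈ F then
      if Feature.zero ∈ F ∨ Feature.one ∈ F then .ba else .median
    else if Feature.sum ∈ F then
      if Feature.zero ∈ F ∧ Feature.one ∈ F ∨ Feature.neg ∈ F ∧ (Feature.zero ∈ F ∨ Feature.one ∈ F)
      then .addZeroOne
      else if Feature.zero ∈ F then .add else if Feature.one ∈ F then .addOne
      else if Feature.neg ∈ F then .sumOne else .sum
    else if Feature.neg ∈ F then
      if Feature.zero ∈ F ∨ Feature.one ∈ F then .negZeroOne else .neg
    else if Feature.zero ∈ F then if Feature.one ∈ F then .zeroOne else .zero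
    else if Feature.one ∈ F then .one else .id
  refine ⟨i, fun p c₁ c₂ c₃ c₄ c₅ => ?_⟩
  rw [hall, hall]
  by_cases h0 : Feature.zero ∈ F <;> by_cases h1 : Feature.one ∈ F <;>
    by_cases h2 : Feature.neg ∈ F <;> by_cases h3 : Feature.sum ∈ F <;>
    by_cases h4 : Feature.median ∈ F <;>
    simp only [i, h0, h1, h2, h3, h4, Node.features, if_true, if_false, or_true,
      and_true, true_and, or_false, and_false, decide_true, decide_false,
      reduceCtorEq, forall_const, false_imp_iff, ne_eq, not_true_eq_false, not_false_eq_true,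
      Bool.false_eq_true] <;> clear h0 h1 h2 h3 h4 hall i <;> grind

/-- The classification of functional reducts up to interdefinability. -/
theorem FunctionalReduct.exists_interdefinable_node (R : FunctionalReduct B) :
    ∃ i : Node, R.Interdefinable (i.reduct B) := by
  choose F hF using fun t : TermOp B => t.exists_features
  obtain ⟨i, hi⟩ := exists_node_of_features (B := B) {f | ∃ t ∈ R.ops, f ∈ F t}
  have key : ∀ S : FunctionalReduct B, S.Defines R ↔ S.Defines (i.reduct B) := by
    intro S
    rw [hi]
    constructor
    · rintro h f ⟨t, ht, hf⟩
      exact (hF t S).1 (h t ht) f hf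
    · intro h t ht
      exact (hF t S).2 fun f hf => h f ⟨t, ht, hf⟩
  exact ⟨i, (key R).1 (Defines.refl R), (key _).2 (Defines.refl _)⟩

/-- Equal groups force the same node, and both reducts are interdefinable with the reduct of their
node. -/
theorem FunctionalReduct.interdefinable_iff_aut_eq (atomless : ∀ a : B, ¬ IsAtom a)
    {R S : FunctionalReduct B} : R.Interdefinable S ↔ R.aut = S.aut := by
  refine ⟨Interdefinable.aut_eq, fun h => ?_⟩
  obtain ⟨i, hi⟩ := R.exists_interdefinable_node
  obtain ⟨j, hj⟩ := S.exists_interdefinable_node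
  obtain rfl : i = j := Node.aut_injective atomless (hi.aut_eq.symm.trans (h.trans hj.aut_eq))
  exact hi.trans hj.symm

theorem FunctionalReduct.range_aut :
    Set.range (fun R : FunctionalReduct B => R.aut) =
      Set.range (fun i : Node => (i.reduct B).aut) := by
  refine Set.Subset.antisymm ?_ ?_
  · rintro _ ⟨R, rfl⟩
    obtain ⟨i, hi⟩ := R.exists_interdefinable_node
    exact ⟨i, hi.aut_eq.symm⟩
  · rintro _ ⟨i, rfl⟩
    exact ⟨i.reduct B, rfl⟩

theorem FunctionalReduct.ncard_range_aut (atomless : ∀ a : B, ¬ IsAtom a) :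
    (Set.range (fun R : FunctionalReduct B => R.aut)).ncard = 13 := by
  rw [range_aut, ← Set.image_univ, Set.ncard_image_of_injective _ (Node.aut_injective atomless),
    Set.ncard_univ, Nat.card_eq_fintype_card]
  rfl

theorem FunctionalReduct.exists_isLeast_aut (atomless : ∀ a : B, ¬ IsAtom a)
    (R S : FunctionalReduct B) : ∃ U : FunctionalReduct B,
      IsLeast {G | G ∈ Set.range (fun V : FunctionalReduct B => V.aut) ∧ R.aut ≤ G ∧ S.aut ≤ G}
        U.aut := by
  obtain ⟨i, hi⟩ := R.exists_interdefinable_node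
  obtain ⟨j, hj⟩ := S.exists_interdefinable_node
  obtain ⟨k, hik, hjk, hk⟩ := Node.exists_sup i j
  rw [hi.aut_eq, hj.aut_eq]
  refine ⟨k.reduct B, ⟨⟨_, rfl⟩, (Node.aut_le_iff atomless).2 hik,
    (Node.aut_le_iff atomless).2 hjk⟩, ?_⟩
  rintro _ ⟨⟨V, rfl⟩, h1, h2⟩
  obtain ⟨l, hl⟩ := V.exists_interdefinable_node
  change _ ≤ V.aut
  replace h1 : _ ≤ V.aut := h1
  replace h2 : _ ≤ V.aut := h2
  rw [hl.aut_eq] at h1 h2 ⊢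
  exact (Node.aut_le_iff atomless).2
    (hk l ((Node.aut_le_iff atomless).1 h1) ((Node.aut_le_iff atomless).1 h2))

theorem FunctionalReduct.exists_not_isLinear_iff (atomless : ∀ a : B, ¬ IsAtom a)
    (R : FunctionalReduct B) : (∃ t ∈ R.ops, ¬ t.IsLinear) ↔
      R.aut = (Node.ba.reduct B).aut ∨ R.aut = (Node.median.reduct B).aut := by
  constructor
  · rintro ⟨t, ht, hl⟩
    obtain ⟨i, hi⟩ := R.exists_interdefinable_node
    have hR : R.Defines (Node.median.reduct B) :=
      defines_cons.2 ⟨DefFun.median_of_not_isLinear hl (defFun_of_mem ht), defines_nil.2 trivial⟩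
    have hle := hR.aut_le
    rw [hi.aut_eq] at hle ⊢
    have key : ∀ i : Node, i.Le .median → i = .ba ∨ i = .median := by decide
    rcases key i ((Node.aut_le_iff atomless).1 hle) with rfl | rfl
    exacts [Or.inl rfl, Or.inr rfl]
  · intro h
    by_contra hne
    push Not at hne
    -- All features needed for linear operations are available over +, 0, 1, so the group of a
    -- linear reduct contains that of `addZeroOne`; neither non-linear group does.
    have hd : (Node.addZeroOne.reduct B).Defines R := by
      intro t ht
      obtain ⟨s, c, h⟩ := TermOp.isLinear_iff.1 (hne t ht)
      refine (defFun_iff_linearFeatures h).2 fun f hf =>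
        defines_node_iff.1 (Defines.refl _) f ?_
      rcases hf with ⟨-, rfl⟩ | ⟨-, rfl⟩ | ⟨-, -, rfl⟩
      · cases c <;> rfl
      · rfl
      · rfl
    have hle := hd.aut_le
    rcases h with h | h <;> rw [h] at hle
    · exact absurd ((Node.aut_le_iff atomless).1 hle) (by decide)
    · exact absurd ((Node.aut_le_iff atomless).1 hle) (by decide)

theorem FunctionalReduct.ncard_range_interdefinable (atomless : ∀ a : B, ¬ IsAtom a) :
    (Set.range (fun R : FunctionalReduct B => {S | R.Interdefinable S})).ncard = 13 := by
  rw [← ncard_range_aut atomless]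
  have hcomp : (fun R : FunctionalReduct B => {S | R.Interdefinable S}) =
      (fun G : Subgroup (Equiv.Perm B) => {S : FunctionalReduct B | G = S.aut}) ∘
        fun R => R.aut := by
    ext R S
    exact interdefinable_iff_aut_eq atomless
  rw [hcomp, Set.range_comp]
  refine Set.InjOn.ncard_image ?_
  rintro _ ⟨R, rfl⟩ G - h
  -- A class determines its group, because `R` lies in its own class.
  have : R ∈ {S : FunctionalReduct B | G = S.aut} := (Set.ext_iff.1 h R).1 rfl
  exact Eq.symm this

end Classification

end BooleanReduct

/-! ### The main theorem -/

open BooleanReduct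
theorem theorem4 {B : Type*} [BooleanAlgebra B] [Countable B] [Nontrivial B]
    (atomless : ∀ a : B, ¬ IsAtom a) :
    -- the automorphism groups of functional reducts are exactly the thirteen groups of the nodes
    (Set.range (fun R : FunctionalReduct B => R.aut)
      = Set.range (fun i : Node => (i.reduct B).aut)) ∧
    -- their inclusion order is exactly the order of the diagram
    (∀ i j : Node, (i.reduct B).aut ≤ (j.reduct B).aut ↔ i.Below j) ∧
    -- there are thirteen of them
    (Set.range (fun R : FunctionalReduct B => R.aut)).ncard = 13 ∧
    -- they form a lattice, with intersections as meets
    (∀ R S : FunctionalReduct B, ∃ U : FunctionalReduct B, U.aut = R.aut ⊓ S.aut) ∧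
    (∀ R S : FunctionalReduct B, ∃ U : FunctionalReduct B,
      IsLeast {G | G ∈ Set.range (fun V : FunctionalReduct B => V.aut) ∧ R.aut ≤ G ∧ S.aut ≤ G}
        U.aut) ∧
    -- the two groups of the non-linear reducts
    (∀ R : FunctionalReduct B, (∃ t ∈ R.ops, ¬ t.IsLinear) ↔
      R.aut = (Node.ba.reduct B).aut ∨ R.aut = (Node.median.reduct B).aut) ∧
    -- the three further groups as intersections
    (Node.zeroOne.reduct B).aut = (Node.zero.reduct B).aut ⊓ (Node.one.reduct B).aut ∧
    (Node.negZeroOne.reduct B).aut =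
      (Node.zero.reduct B).aut ⊓ (Node.one.reduct B).aut ⊓ (Node.neg.reduct B).aut ∧
    (Node.addZeroOne.reduct B).aut =
      (Node.zero.reduct B).aut ⊓ (Node.one.reduct B).aut ⊓ (Node.sum.reduct B).aut ∧
    -- interdefinability is equality of automorphism groups, and it has thirteen classes
    (∀ R S : FunctionalReduct B, R.Interdefinable S ↔ R.aut = S.aut) ∧
    (Set.range (fun R : FunctionalReduct B => {S | R.Interdefinable S})).ncard = 13 := by
  refine ⟨FunctionalReduct.range_aut,
    fun i j => (Node.aut_le_iff atomless).trans Node.below_iff_le.symm,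
    FunctionalReduct.ncard_range_aut atomless,
    fun R S => ⟨_, FunctionalReduct.aut_append R S⟩,
    FunctionalReduct.exists_isLeast_aut atomless,
    FunctionalReduct.exists_not_isLinear_iff atomless, ?_, ?_, ?_,
    fun R S => FunctionalReduct.interdefinable_iff_aut_eq atomless,
    FunctionalReduct.ncard_range_interdefinable atomless⟩
  · rw [← FunctionalReduct.aut_append]
    rfl
  · rw [← FunctionalReduct.aut_append, ← FunctionalReduct.aut_append]
    refine FunctionalReduct.aut_eq_of_defines_iff fun T => ?_
    simp only [Node.reduct, List.cons_append, List.nil_append, defines_cons, defines_nil]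
    tauto
  · rw [← FunctionalReduct.aut_append, ← FunctionalReduct.aut_append]
    refine FunctionalReduct.aut_eq_of_defines_iff fun T => ?_
    simp only [Node.reduct, List.cons_append, List.nil_append, defines_cons, defines_nil,
      defFun_addOp_iff]
    tauto
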